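/- **Model.** In the $d$-bit Word RAM, registers and memory cells hold words in $\{0,\dots,2^d-1\}$, an address consists of $O(1)$ words, and each of the following takes one unit of time: reading or writing a cell, addition, subtraction, multiplication, division with rounding, comparison, bit operations, and drawing a uniformly random $d$-bit word. Fix a constant $c$ and consider word lengths with $N<2^{cd}$ (that is, $d\in\Omega(\log N)$), $N\ge 1$. **Deletion-only DPSS with float weights.** Initially there are $N$ items; item $x$ has a float weight $w(x)=m_x\cdot 2^{e_x}\ge 0$, where $e_x$ and $m_x$ are non-negative integers of $O(1)$ words each. After preprocessing, the item set $S$ undergoes deletions, and for parameters $(\alpha,\beta)$, which are non-negative rationals with $O(1)$-word numerators and denominators and with $W_S(\alpha,\beta)=\alpha\sum_{x\in S}w(x)+\beta>0$, a query returns a random subset $T\subseteq S$ that contains each $x\in S$ independently with probability $p_x(\alpha,\beta)=\min\{w(x)/W_S(\alpha,\beta),1\}$. The result of a query is independent of the results of earlier queries; $\mu=\sum_{x\in S}p_x(\alpha,\beta)$ is its expected size. **Theorem.** Suppose that an algorithm for deletion-only DPSS on $N$ initial items with float weights has worst-case preprocessing time $t_p(N)$, expected time at most $(1+\mu)\cdot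 t_q(N)$ for every query (conditioned on the results of the earlier queries), and worst-case deletion time $t_{del}(N)$. Then $N$ integers of $O(1)$ words each can be sorted on the $d$-bit Word RAM with $d\in\Omega(\log N)$ in expected time $$t_p(N)+O\bigl(N\cdot(t_q(N)+t_{del}(N))\bigr).$$ Precisely: if the exponents have at least $k+c$ words, and the mantissas and the parameters at least one word, then there is a constant $C$, depending only on $c$, $k$ and the numbers of words of exponents, mantissas and parameters, such that for every set $D$ of pairs $(N,d)$ with $1\le N<2^{cd}$ and every algorithm that satisfies the above for all $(N,d)\in D$, there is one program that, for all $(N,d)\in D$, sorts any $N$ integers of $k$ words (not necessarily distinct) on the $d$-bit Word RAM, always correctly, in expected time at most $t_p(N)+C\cdot N\cdot(t_q(N)+t_{del}(N))$. -/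

import Mathlib

open scoped NNReal ENNReal

/-! ## The Word RAM with `d`-bit words -/

namespace WordRAM

/-- A memory address of the `d`-bit machine.  It consists of a constant number of words: the
list `row` of words is computed by the program at run time, whereas `tbl` and `col` are literal
constants of the program text.  So a program reaches at most `2 ^ O(d)` cells. -/
@[ext] structure Addr (d : ℕ) where
  tbl : ℕ
  col : ℕ
  row : List (BitVec d)

/-- The contents of the registers and of the memory; each register and each memory cell holds one
word.  A program mentions only finitely many registers. -/
@[ext] structure Store (d : ℕ) where
  reg : ℕ → BitVec d
  mem : Addr d → BitVec d

/-- Binary operations on words.  `mul` and `mulHi` give the low and the high word of a product,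
`div` and `mod` are quotient (rounded down) and remainder. -/
inductive BinOp
  | add | sub | mul | mulHi | div | mod | and | or | xor | shl | shr

/-- Unary operations on words: complement, index of the highest and of the lowest non-zero bit. -/
inductive UnOp
  | not | highBit | lowBit

def BinOp.eval {d : ℕ} (o : BinOp) (a b : BitVec d) : BitVec d :=
  match o with
  | .add => a + b
  | .sub => a - b
  | .mul => a * b
  | .mulHi => BitVec.ofNat d (a.toNat * b.toNat / 2 ^ d)
  | .div => a / b
  | .mod => a % b
  | .and => a &&& b
  | .or => a ||| b
  | .xor => a ^^^ b
  | .shl => a <<< b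
  | .shr => a >>> b

def UnOp.eval {d : ℕ} (o : UnOp) (a : BitVec d) : BitVec d :=
  match o with
  | .not => ~~~a
  | .highBit => BitVec.ofNat d (Nat.log 2 a.toNat)
  | .lowBit => BitVec.ofNat d (padicValNat 2 a.toNat)

/-- Instructions; each of them takes one unit of time.  Registers are named by natural numbers,
`row` is a list of registers, and jump targets are positions in the program. -/
inductive Instr
  /-- `r := v mod 2 ^ d` for a literal `v` -/
  | const (r v : ℕ)
  /-- `r := a` -/
  | copy (r a : ℕ)
  /-- `r := o a` -/
  | un (o : UnOp) (r a : ℕ)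
  /-- `r := o a b` -/
  | bin (o : BinOp) (r a b : ℕ)
  /-- `r :=` a uniformly random word, independent of everything before -/
  | rand (r : ℕ)
  /-- `r :=` content of the memory cell `(tbl, col, row)` -/
  | load (r tbl col : ℕ) (row : List ℕ)
  /-- content of the memory cell `(tbl, col, row)` `:= r` -/
  | store (tbl col : ℕ) (row : List ℕ) (r : ℕ)
  /-- continue at position `l` -/
  | jump (l : ℕ)
  /-- continue at position `l` if `a < b` as unsigned integers -/
  | jumpLt (a b l : ℕ)
  /-- continue at position `l` if `a = b` -/
  | jumpEq (a b l : ℕ)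
  /-- stop -/
  | halt

/-- A program does not depend on the word length. -/
abbrev Program := List Instr

variable {d : ℕ}

def Store.setReg (s : Store d) (r : ℕ) (w : BitVec d) : Store d :=
  { s with reg := fun r' => if r' = r then w else s.reg r' }

open Classical in
noncomputable def Store.setMem (s : Store d) (a : Addr d) (w : BitVec d) : Store d :=
  { s with mem := fun a' => if a' = a then w else s.mem a' }

/-- The address denoted by `(tbl, col, row)`, where `row` is a list of registers. -/
def Store.addr (s : Store d) (tbl col : ℕ) (row : List ℕ) : Addr d :=
  ⟨tbl, col, row.map s.reg⟩

/-- A configuration: the position of the next instruction (`none` once the machine has halted)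
and the store. -/
@[ext] structure Config (d : ℕ) where
  pc : Option ℕ
  store : Store d

/-- The distribution of the configuration after the instruction at position `i`. -/
noncomputable def Instr.exec (c : Instr) (i : ℕ) (s : Store d) : PMF (Config d) :=
  match c with
  | .const r v => PMF.pure ⟨some (i + 1), s.setReg r (BitVec.ofNat d v)⟩
  | .copy r a => PMF.pure ⟨some (i + 1), s.setReg r (s.reg a)⟩
  | .un o r a => PMF.pure ⟨some (i + 1), s.setReg r (o.eval (s.reg a))⟩
  | .bin o r a b => PMF.pure ⟨some (i + 1), s.setReg r (o.eval (s.reg a) (s.reg b))⟩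
  | .rand r =>
      (PMF.uniformOfFintype (BitVec d)).map fun w => ⟨some (i + 1), s.setReg r w⟩
  | .load r tbl col row =>
      PMF.pure ⟨some (i + 1), s.setReg r (s.mem (s.addr tbl col row))⟩
  | .store tbl col row r =>
      PMF.pure ⟨some (i + 1), s.setMem (s.addr tbl col row) (s.reg r)⟩
  | .jump l => PMF.pure ⟨some l, s⟩
  | .jumpLt a b l =>
      PMF.pure ⟨some (if (s.reg a).toNat < (s.reg b).toNat then l else i + 1), s⟩
  | .jumpEq a b l => PMF.pure ⟨some (if s.reg a = s.reg b then l else i + 1), s⟩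
  | .halt => PMF.pure ⟨none, s⟩

/-- One step of the program `P`.  A position outside the program acts as `halt`, and halted
configurations do not change any more. -/
noncomputable def step (P : Program) (x : Config d) : PMF (Config d) :=
  match x.pc with
  | none => PMF.pure x
  | some i => (P.getD i .halt).exec i x.store

/-- The distribution of the configuration after `n` steps. -/
noncomputable def runFor (P : Program) : ℕ → Config d → PMF (Config d)
  | 0, x => PMF.pure x
  | n + 1, x => (step P x).bind (runFor P n)

/-- A program starts at its first instruction. -/
def start (s : Store d) : Config d := ⟨some 0, s⟩

/-- The probability that `P`, started on `s`, halts with final store `s'`. -/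
noncomputable def finalMass (P : Program) (s s' : Store d) : ℝ≥0∞ :=
  ⨆ n : ℕ, runFor P n (start s) ⟨none, s'⟩

/-- The expected number of steps until `P`, started on `s`, halts: the sum over all `n` of the
probability that `P` has not halted after `n` steps. -/
noncomputable def expectedTime (P : Program) (s : Store d) : ℝ≥0∞ :=
  ∑' n : ℕ, (runFor P n (start s)).toOuterMeasure {x | x.pc ≠ none}

/-- `P`, started on `s`, halts after at most `n` steps, whatever the random words are. -/
def HaltsWithin (P : Program) (s : Store d) (n : ℕ) : Prop :=
  ∀ x ∈ (runFor P n (start s)).support, x.pc = none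

/-! ### Multi-word numbers and arrays in memory -/

/-- The `j`-th word (least significant first) of the natural number `v`. -/
def numWord (d v j : ℕ) : BitVec d := BitVec.ofNat d (v / 2 ^ (d * j))

/-- The row index that represents the number `i` by `c` words. -/
def rowOf (d c i : ℕ) : List (BitVec d) := (List.range c).map (numWord d i)

/-- The number represented by the words of a row index. -/
def rowVal (row : List (BitVec d)) : ℕ := Nat.ofDigits (2 ^ d) (row.map BitVec.toNat)

/-- The `n`-word number stored in the columns `0, …, n - 1` of the given row of a table. -/
def Store.readNum (s : Store d) (tbl n : ℕ) (row : List (BitVec d)) : ℕ :=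
  ∑ j ∈ Finset.range n, (s.mem ⟨tbl, j, row⟩).toNat * 2 ^ (d * j)

/-- Write the `n`-word number `v` into the columns `0, …, n - 1` of the row `[]` of a table. -/
def Store.writeNum (s : Store d) (tbl n v : ℕ) : Store d :=
  { s with mem := fun a =>
      if a.tbl = tbl ∧ a.col < n ∧ a.row = [] then numWord d v a.col else s.mem a }

/-- The initial store for an input that consists of a number `N` and of arrays `f t` of `N`
numbers each, where `N` and the indices `0, …, N - 1` are represented by `c` words: `N` is in the
row `[]` of table `0`, and `f t i` is in the row `rowOf d c i` of table `t`, for `t ≥ 1`.  All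
registers and all other memory cells are zero. -/
def inputStore (d c N : ℕ) (f : ℕ → Fin N → ℕ) : Store d where
  reg := fun _ => 0
  mem := fun a =>
    if a.tbl = 0 then
      if a.row = [] then numWord d N a.col else 0
    else if h : a.row.length = c ∧ rowVal a.row < N then
      numWord d (f a.tbl ⟨rowVal a.row, h.2⟩) a.col
    else 0

/-! ### Integer Sorting -/

/-- The final store `s` holds in table `2` the numbers `a 0, …, a (N - 1)` (with multiplicities,
each in `k` words) in non-decreasing order. -/
def IsSortedOutput (c k : ℕ) {N : ℕ} (a : Fin N → ℕ) (s : Store d) : Prop :=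
  (List.ofFn fun i : Fin N => s.readNum 2 k (rowOf d c i)).Perm (List.ofFn a) ∧
  (List.ofFn fun i : Fin N => s.readNum 2 k (rowOf d c i)).Pairwise (· ≤ ·)

/-- For all `(N, d) ∈ D`, the program `P` sorts any `N` integers of `k` words (given in table `1`)
on the `d`-bit Word RAM in expected time at most `time N`.  The output is correct whenever the
program halts, and it halts with probability one because the expected time is finite. -/
def SortsIntegers (P : Program) (c k : ℕ) (D : Set (ℕ × ℕ)) (time : ℕ → ℝ≥0) : Prop :=
  ∀ N d : ℕ, (N, d) ∈ D → ∀ a : Fin N → ℕ, (∀ i, a i < 2 ^ (d * k)) →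
    expectedTime P (inputStore d c N fun t => if t = 1 then a else 0) ≤ (time N : ℝ≥0∞) ∧
    ∀ s' : Store d, finalMass P (inputStore d c N fun t => if t = 1 then a else 0) s' ≠ 0 →
      IsSortedOutput c k a s'

end WordRAM

/-! ## Deletion-only dynamic parameterized subset sampling with float weights -/

namespace DPSS

open WordRAM

/-- Numbers of words used for: set sizes and item names; exponents and mantissas of the float
weights; numerators and denominators of the query parameters. -/
structure Format where
  indexWords : ℕ
  expWords : ℕ
  mantWords : ℕ
  paramWords : ℕ

/-- `N` items `0, …, N - 1` with float weights `mant i * 2 ^ exp i`. -/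
structure Items (F : Format) (d N : ℕ) where
  exp : Fin N → ℕ
  mant : Fin N → ℕ
  exp_lt : ∀ i, exp i < 2 ^ (d * F.expWords)
  mant_lt : ∀ i, mant i < 2 ^ (d * F.mantWords)

/-- Query parameters `α = aNum / aDen` and `β = bNum / bDen`. -/
structure Params (F : Format) (d : ℕ) where
  aNum : ℕ
  aDen : ℕ
  bNum : ℕ
  bDen : ℕ
  aNum_lt : aNum < 2 ^ (d * F.paramWords)
  aDen_lt : aDen < 2 ^ (d * F.paramWords)
  bNum_lt : bNum < 2 ^ (d * F.paramWords)
  bDen_lt : bDen < 2 ^ (d * F.paramWords)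
  aDen_pos : 0 < aDen
  bDen_pos : 0 < bDen

variable {F : Format} {d N : ℕ}

noncomputable def Params.alpha (p : Params F d) : ℝ≥0 := p.aNum / p.aDen

noncomputable def Params.beta (p : Params F d) : ℝ≥0 := p.bNum / p.bDen

noncomputable def Items.weight (I : Items F d N) (x : Fin N) : ℝ≥0 := I.mant x * 2 ^ I.exp x

/-- `W_S(α, β) = α * ∑ x ∈ S, w x + β`. -/
noncomputable def Items.totalWeight (I : Items F d N) (S : Finset (Fin N)) (p : Params F d) :
    ℝ≥0 :=
  p.alpha * ∑ x ∈ S, I.weight x + p.beta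

/-- `p_x(α, β) = min (w x / W_S(α, β)) 1`. -/
noncomputable def Items.prob (I : Items F d N) (S : Finset (Fin N)) (p : Params F d)
    (x : Fin N) : ℝ≥0 :=
  min (I.weight x / I.totalWeight S p) 1

/-- `μ_S(α, β)`, the expected size of the sample. -/
noncomputable def Items.mu (I : Items F d N) (S : Finset (Fin N)) (p : Params F d) : ℝ≥0 :=
  ∑ x ∈ S, I.prob S p x

/-- The probability of the outcome `T` if each `x ∈ S` is selected independently with probability
`p_x(α, β)`. -/
noncomputable def Items.sampleProb (I : Items F d N) (S : Finset (Fin N)) (p : Params F d)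
    (T : Finset (Fin N)) : ℝ≥0 :=
  if T ⊆ S then (∏ x ∈ T, I.prob S p x) * ∏ x ∈ S \ T, (1 - I.prob S p x) else 0

/-- The three routines of a deletion-only data structure: preprocessing, query, deletion.  Between
two calls, all registers and the whole memory are kept. -/
structure Algorithm where
  init : Program
  query : Program
  delete : Program

/-- The store on which the preprocessing starts: exponents in table `1`, mantissas in
table `2`. -/
def Items.initStore (I : Items F d N) : Store d :=
  inputStore d F.indexWords N fun t => if t = 1 then I.exp else if t = 2 then I.mant else 0

/-- The caller of a deletion writes the name of the item to be deleted into table `3`. -/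
def setItem (F : Format) (x : Fin N) (s : Store d) : Store d :=
  s.writeNum 3 F.indexWords x

/-- The caller of a query writes the query parameters into the tables `4, …, 7`. -/
def setParams (p : Params F d) (s : Store d) : Store d :=
  (((s.writeNum 4 F.paramWords p.aNum).writeNum 5 F.paramWords p.aDen).writeNum
    6 F.paramWords p.bNum).writeNum 7 F.paramWords p.bDen

/-- The store `s` holds the query result `T`: its size is in table `8`, and a list of its elements
without repetitions is in table `9`. -/
def Returns (F : Format) (s : Store d) (T : Finset (Fin N)) : Prop :=
  ∃ l : List (Fin N), l.Nodup ∧ l.toFinset = T ∧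
    s.readNum 8 F.indexWords [] = l.length ∧
    ∀ (i : ℕ) (hi : i < l.length),
      s.readNum 9 F.indexWords (rowOf d F.indexWords i) = (l[i] : ℕ)

/-- What the user of the data structure sees of one operation: a query with its parameters and its
result, or a deletion. -/
inductive Event (F : Format) (d N : ℕ)
  | query (p : Params F d) (T : Finset (Fin N))
  | delete (x : Fin N)

/-- A sequence of operations and results, the latest one first. -/
abbrev History (F : Format) (d N : ℕ) := List (Event F d N)

/-- The current item set after a history. -/
def live : History F d N → Finset (Fin N)
  | [] => Finset.univ
  | .query _ _ :: h => live h
  | .delete x :: h => (live h).erase x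

/-- Only items of the current set are deleted, and a query is only made if its parameterized total
weight is not zero, so that the sampling probabilities are defined. -/
def Legal (I : Items F d N) : History F d N → Prop
  | [] => True
  | .query p _ :: h => Legal I h ∧ 0 < I.totalWeight (live h) p
  | .delete x :: h => Legal I h ∧ x ∈ live h

open Classical in
/-- The probability that, when the operations of the history `h` are carried out one after the
other, the queries have the results given in `h` and the final store is `s'`. -/
noncomputable def Algorithm.mass (A : Algorithm) (I : Items F d N) :
    History F d N → Store d → ℝ≥0∞
  | [], s' => finalMass A.init I.initStore s'
  | .query p T :: h, s' =>
      if Returns F s' T then ∑' s, A.mass I h s * finalMass A.query (setParams p s) s' else 0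
  | .delete x :: h, s' => ∑' s, A.mass I h s * finalMass A.delete (setItem F x s) s'

/-- The probability that the queries in the history `h` have the results given in `h`. -/
noncomputable def Algorithm.histProb (A : Algorithm) (I : Items F d N) (h : History F d N) :
    ℝ≥0∞ :=
  ∑' s, A.mass I h s

/-- For all `(N, d) ∈ D`, the algorithm `A` solves deletion-only DPSS for `N` initial items with
float weights on the `d`-bit Word RAM, with preprocessing time `tp N` and deletion time `td N` in
the worst case, and expected time `(1 + μ) * tq N` for a query.  Conditioned on the results of the
earlier queries, the result of a query is a correct sample, and the bound on its expected time
holds; so the operations may be chosen adaptively. -/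
structure Algorithm.Solves (A : Algorithm) (F : Format) (D : Set (ℕ × ℕ))
    (tp tq td : ℕ → ℝ≥0) : Prop where
  init_time : ∀ N d : ℕ, (N, d) ∈ D → ∀ I : Items F d N,
    HaltsWithin A.init I.initStore ⌊tp N⌋₊
  query_law : ∀ N d : ℕ, (N, d) ∈ D → ∀ (I : Items F d N) (h : History F d N) (p : Params F d),
    Legal I h → 0 < I.totalWeight (live h) p → ∀ T : Finset (Fin N),
      A.histProb I (.query p T :: h) = A.histProb I h * (I.sampleProb (live h) p T : ℝ≥0∞)
  query_time : ∀ N d : ℕ, (N, d) ∈ D → ∀ (I : Items F d N) (h : History F d N) (p : Params F d),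
    Legal I h → 0 < I.totalWeight (live h) p →
      ∑' s, A.mass I h s * expectedTime A.query (setParams p s) ≤
        A.histProb I h * (((1 + I.mu (live h) p) * tq N : ℝ≥0) : ℝ≥0∞)
  delete_time : ∀ N d : ℕ, (N, d) ∈ D → ∀ (I : Items F d N) (h : History F d N) (x : Fin N),
    Legal I h → x ∈ live h → ∀ s, A.mass I h s ≠ 0 →
      HaltsWithin A.delete (setItem F x s) ⌊td N⌋₊

end DPSS

/-!
Sorting by a deletion-only data structure for subset sampling.

A key `a i` becomes an item of weight `2 ^ e i`, whose exponent `e i` consists of the words of `a i`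
followed by those of the index `i`.  So the exponents are distinct, and the largest weight exceeds
the sum of all the others.  Every query uses `α = a / (2 * a + 1)` and `β = 1 / (2 * a + 1)`, where
`2 * a + 1 = 2 ^ d - 1` is the greatest word.  As `α` is less than `1 / 2`, the item `z` with the
largest exponent satisfies `w z ≥ W` and is sampled with probability one (`prob_max_eq_one`), while
the expected size of the sample stays bounded (`mu_le`).  Hence the largest item of the sample is the
largest item of the current set, with certainty: `N` rounds of querying, taking the maximum of the
sample, putting it out and deleting it sort the keys, and the set of remaining items is determined
by the number of rounds.  A deletion takes at least one step, so constant costs per item are absorbed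
by `N * td N`; this includes the preprocessing of the input.

The expected time is bounded through `cost`, the expected number of steps plus an expected payment
that depends on the final store.  With an infinite payment for wrong outputs, a finite bound shows
correctness as well.  The program is written in a small structured language `Cmd`; `Cmd.wp` is the
largest cost of a command over all places where its code may stand, and `Cmd.Det` describes commands
whose effect is not random.  The given algorithm is run as a guest: its register `r` becomes the
register `2 * r + 1` and its table `t` the table `t + 3`, while the sorting program itself uses even
registers and the tables `0`, `1`, `2`.  Every run of the guest is then copied step by step
(`step_hostConfig`).  Finally `tsum_remainingCost_le` combines the costs of the rounds by induction on
the number of remaining items, averaging over the stores that are compatible with a history.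
-/

/-! ### Expected cost of a program -/

namespace WordRAM

variable {d : ℕ}

/-- The expectation of `F` under `p`. -/
noncomputable def expect {α : Type*} (p : PMF α) (F : α → ℝ≥0∞) : ℝ≥0∞ := ∑' a, p a * F a

lemma expect_mono {α : Type*} (p : PMF α) {F G : α → ℝ≥0∞} (h : ∀ a, F a ≤ G a) :
    expect p F ≤ expect p G :=
  ENNReal.tsum_le_tsum fun a => by gcongr; exact h a

lemma expect_pure {α : Type*} (a : α) (F : α → ℝ≥0∞) : expect (PMF.pure a) F = F a := by
  unfold expect
  rw [tsum_eq_single a]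
  · simp
  · intro b hb
    simp [PMF.pure_apply, hb]

lemma expect_bind {α β : Type*} (p : PMF α) (f : α → PMF β) (F : β → ℝ≥0∞) :
    expect (p.bind f) F = expect p fun a => expect (f a) F := by
  unfold expect
  simp only [PMF.bind_apply, ← ENNReal.tsum_mul_right, ← ENNReal.tsum_mul_left]
  rw [ENNReal.tsum_comm]
  simp only [mul_assoc]

lemma expect_map {α β : Type*} (p : PMF α) (f : α → β) (F : β → ℝ≥0∞) :
    expect (p.map f) F = expect p fun a => F (f a) := by
  rw [← PMF.bind_pure_comp, expect_bind]
  simp [expect_pure]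

lemma expect_add {α : Type*} (p : PMF α) (F G : α → ℝ≥0∞) :
    expect p (fun a => F a + G a) = expect p F + expect p G := by
  simp [expect, mul_add, ENNReal.tsum_add]

lemma expect_sum {α : Type*} (p : PMF α) (n : ℕ) (F : ℕ → α → ℝ≥0∞) :
    expect p (fun a => ∑ k ∈ Finset.range n, F k a) =
      ∑ k ∈ Finset.range n, expect p (F k) := by
  induction n with
  | zero => simp [expect]
  | succ n ih => simp only [Finset.sum_range_succ, expect_add, ih]

/-- The expected number of steps within the first `n` steps from `x` on, plus the expectation of
the payment `G` on the final store, which is due only if the machine halts within `n` steps. -/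
noncomputable def costWithin (P : Program) (G : Store d → ℝ≥0∞) : ℕ → Config d → ℝ≥0∞
  | 0, x => if x.pc = none then G x.store else 0
  | n + 1, x => if x.pc = none then G x.store else 1 + expect (step P x) (costWithin P G n)

/-- The expected number of steps from `x` on plus the expected payment `G` on the final store. -/
noncomputable def cost (P : Program) (G : Store d → ℝ≥0∞) (x : Config d) : ℝ≥0∞ :=
  ⨆ n, costWithin P G n x

lemma costWithin_le_cost (P : Program) (G : Store d → ℝ≥0∞) (n : ℕ) (x : Config d) :
    costWithin P G n x ≤ cost P G x := le_iSup (fun n => costWithin P G n x) n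

lemma cost_none (P : Program) (G : Store d → ℝ≥0∞) (s : Store d) :
    cost P G ⟨none, s⟩ = G s := by
  have : ∀ n, costWithin P G n ⟨none, s⟩ = G s := by
    intro n; cases n <;> simp [costWithin]
  simp [cost, this]

lemma cost_some_le (P : Program) (G : Store d → ℝ≥0∞) (i : ℕ) (s : Store d) :
    cost P G ⟨some i, s⟩ ≤ 1 + expect ((P.getD i .halt).exec i s) (cost P G) := by
  refine iSup_le fun n => ?_
  cases n with
  | zero => simp [costWithin]
  | succ n =>
    simp only [costWithin, step]
    rw [if_neg (by simp)]
    gcongr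
    exact expect_mono _ fun a => costWithin_le_cost P G n a

/-- Cost of an instruction whose effect is not random. -/
lemma cost_le_of_exec {P : Program} {G : Store d → ℝ≥0∞} {i : ℕ} {s : Store d} {c : Instr}
    {y : Config d} (hc : P[i]? = some c) (h : c.exec i s = PMF.pure y) :
    cost P G ⟨some i, s⟩ ≤ 1 + cost P G y := by
  refine (cost_some_le P G i s).trans ?_
  rw [List.getD_eq_getElem?_getD, hc, Option.getD_some, h, expect_pure]

lemma runFor_none (P : Program) (n : ℕ) (s : Store d) :
    runFor P n ⟨none, s⟩ = PMF.pure ⟨none, s⟩ := by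
  induction n with
  | zero => rfl
  | succ n ih => simp [runFor, step, ih]

lemma toOuterMeasure_eq_expect {α : Type*} (p : PMF α) (S : Set α) :
    p.toOuterMeasure S = expect p (S.indicator 1) := by
  rw [PMF.toOuterMeasure_apply]
  refine tsum_congr fun a => ?_
  by_cases h : a ∈ S <;> simp [h]

/-- The cost in terms of the distributions of the configurations. -/
lemma costWithin_eq (P : Program) (G : Store d → ℝ≥0∞) (n : ℕ) (x : Config d) :
    costWithin P G n x =
      ∑ k ∈ Finset.range n, (runFor P k x).toOuterMeasure {y | y.pc ≠ none} +
        expect (runFor P n x) (fun y => if y.pc = none then G y.store else 0) := by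
  induction n generalizing x with
  | zero => simp [costWithin, runFor, expect_pure]
  | succ n ih =>
    obtain ⟨pc, s⟩ := x
    cases pc with
    | none => simp [costWithin, runFor_none, expect_pure]
    | some i =>
      rw [Finset.sum_range_succ', costWithin, if_neg (by simp)]
      simp only [toOuterMeasure_eq_expect, runFor, expect_bind, expect_pure]
      rw [← expect_sum, add_comm, add_assoc, add_comm _ (expect _ _), ← add_assoc, ← expect_add]
      simp only [toOuterMeasure_eq_expect] at ih
      congr 1
      · exact congrArg _ (funext fun y => ih y)
      · simp

lemma expect_final (p : PMF (Config d)) (G : Store d → ℝ≥0∞) :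
    expect p (fun y => if y.pc = none then G y.store else 0) = ∑' s, p ⟨none, s⟩ * G s := by
  unfold expect
  have hinj : Function.Injective (fun s : Store d => (⟨none, s⟩ : Config d)) := by
    intro s t h; simpa using h
  rw [← hinj.tsum_eq]
  · simp
  · intro y hy
    obtain ⟨pc, s⟩ := y
    cases pc with
    | none => exact ⟨s, rfl⟩
    | some i => simp at hy

lemma cost_start_le (P : Program) (G : Store d → ℝ≥0∞) (s : Store d) :
    cost P G (start s) ≤ expectedTime P s + ∑' s', finalMass P s s' * G s' := by
  refine iSup_le fun n => ?_
  rw [costWithin_eq, expect_final]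
  gcongr with s'
  · exact ENNReal.sum_le_tsum _
  · exact le_iSup (fun n => runFor P n (start s) ⟨none, s'⟩) n

lemma expectedTime_le_cost (P : Program) (G : Store d → ℝ≥0∞) (s : Store d) :
    expectedTime P s ≤ cost P G (start s) := by
  unfold expectedTime
  rw [ENNReal.tsum_eq_iSup_nat]
  refine iSup_mono fun n => ?_
  rw [costWithin_eq]
  exact le_self_add

lemma cost_eq_top (P : Program) (G : Store d → ℝ≥0∞) {s s' : Store d}
    (h : finalMass P s s' ≠ 0) (hG : G s' = ⊤) : cost P G (start s) = ⊤ := by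
  have : ∃ n, runFor P n (start s) ⟨none, s'⟩ ≠ 0 := by
    by_contra! hc
    exact h (by simp [finalMass, hc])
  obtain ⟨n, hn⟩ := this
  refine top_unique ((le_trans ?_ (costWithin_le_cost P G n _)))
  rw [costWithin_eq, expect_final]
  refine le_add_left (le_trans ?_ (ENNReal.le_tsum s'))
  rw [hG, ENNReal.mul_top hn]

/-! ### Placing a program into a larger one -/

/-- The program `P` has the instructions `L` from position `b` on. -/
def CodeAt (P : Program) (b : ℕ) (L : List Instr) : Prop :=
  ∀ i, i < L.length → P[b + i]? = L[i]?

lemma codeAt_cons {P : Program} {b : ℕ} {x : Instr} {L : List Instr} :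
    CodeAt P b (x :: L) ↔ P[b]? = some x ∧ CodeAt P (b + 1) L := by
  constructor
  · intro h
    refine ⟨by simpa using h 0 (by simp), fun i hi => ?_⟩
    have := h (i + 1) (by simpa using hi)
    rw [show b + 1 + i = b + (i + 1) by ring, this]; simp
  · rintro ⟨h0, h⟩ i hi
    cases i with
    | zero => simpa using h0
    | succ i =>
      have := h i (by simpa using hi)
      rw [show b + (i + 1) = b + 1 + i by ring, this]; simp

lemma codeAt_append {P : Program} {b : ℕ} {L M : List Instr} :
    CodeAt P b (L ++ M) ↔ CodeAt P b L ∧ CodeAt P (b + L.length) M := by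
  induction L generalizing b with
  | nil => simp [CodeAt]
  | cons x L ih =>
    simp only [List.cons_append, codeAt_cons, ih, List.length_cons, and_assoc]
    rw [show b + 1 + L.length = b + (L.length + 1) by ring]

/-- Address translation: a hosted program has its table `t` in table `t + 3` of the host. -/
def Addr.host (a : Addr d) : Addr d := ⟨a.tbl + 3, a.col, a.row⟩

/-- The store that a hosted program sees: its register `r` is the odd register `2 * r + 1` of the
host, and its table `t` is the table `t + 3` of the host. -/
def Store.guest (s : Store d) : Store d where
  reg := fun r => s.reg (2 * r + 1)
  mem := fun a => s.mem a.host

/-- The host store `s` with the part of the hosted program replaced by `v`. -/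
def Store.withGuest (s v : Store d) : Store d where
  reg := fun r => if r % 2 = 1 then v.reg (r / 2) else s.reg r
  mem := fun a => if 3 ≤ a.tbl then v.mem ⟨a.tbl - 3, a.col, a.row⟩ else s.mem a

@[simp] lemma guest_withGuest (s v : Store d) : (s.withGuest v).guest = v := by
  refine Store.ext (funext fun r => ?_) (funext fun a => ?_)
  · simp [Store.guest, Store.withGuest, Nat.add_mod, show (2 * r + 1) / 2 = r by omega]
  · simp [Store.guest, Store.withGuest, Addr.host]

@[simp] lemma withGuest_guest (s : Store d) : s.withGuest s.guest = s := by
  refine Store.ext (funext fun r => ?_) (funext fun a => ?_)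
  · simp only [Store.guest, Store.withGuest]
    split_ifs with h
    · congr 1; omega
    · rfl
  · simp only [Store.guest, Store.withGuest, Addr.host]
    split_ifs with h
    · rw [show a.tbl - 3 + 3 = a.tbl by omega]
    · rfl

@[simp] lemma withGuest_reg_even (s v : Store d) (r : ℕ) :
    (s.withGuest v).reg (2 * r) = s.reg (2 * r) := by
  simp [Store.withGuest]

lemma withGuest_setReg (s v : Store d) (r : ℕ) (w : BitVec d) :
    s.withGuest (v.setReg r w) = (s.withGuest v).setReg (2 * r + 1) w := by
  refine Store.ext (funext fun r' => ?_) rfl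
  · simp only [Store.withGuest, Store.setReg]
    split_ifs <;> first | rfl | omega

lemma withGuest_setMem (s v : Store d) (a : Addr d) (w : BitVec d) :
    s.withGuest (v.setMem a w) = (s.withGuest v).setMem a.host w := by
  refine Store.ext rfl (funext fun b => ?_)
  · simp only [Store.withGuest, Store.setMem]
    by_cases h : 3 ≤ b.tbl
    · have : (⟨b.tbl - 3, b.col, b.row⟩ : Addr d) = a ↔ b = a.host := by
        simp only [Addr.host, Addr.ext_iff]
        constructor
        · rintro ⟨h1, h2, h3⟩; exact ⟨by omega, h2, h3⟩
        · rintro ⟨h1, h2, h3⟩; exact ⟨by omega, h2, h3⟩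
      rw [if_pos h, if_pos h]
      by_cases hb : b = a.host
      · rw [if_pos hb, if_pos (this.2 hb)]
      · rw [if_neg hb, if_neg (mt this.1 hb)]
    · have : b ≠ a.host := by
        rintro rfl; simp [Addr.host] at h
      simp [h, this]

lemma withGuest_reg_odd (s v : Store d) (r : ℕ) :
    (s.withGuest v).reg (2 * r + 1) = v.reg r := by
  simp [Store.withGuest, Nat.add_mod, show (2 * r + 1) / 2 = r by omega]

lemma withGuest_mem_host (s v : Store d) (a : Addr d) :
    (s.withGuest v).mem a.host = v.mem a := by
  simp [Store.withGuest, Addr.host]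

lemma withGuest_addr (s v : Store d) (tbl col : ℕ) (row : List ℕ) :
    (s.withGuest v).addr (tbl + 3) col (row.map fun r => 2 * r + 1) = (v.addr tbl col row).host := by
  simp [Store.addr, Addr.host, Function.comp_def, withGuest_reg_odd]

/-- The instruction of the host that simulates an instruction of a hosted program of length `n`,
placed at position `b`.  Jumps to positions outside the hosted program go to its end. -/
def Instr.host (b n : ℕ) : Instr → Instr
  | .const r v => .const (2 * r + 1) v
  | .copy r a => .copy (2 * r + 1) (2 * a + 1)
  | .un o r a => .un o (2 * r + 1) (2 * a + 1)
  | .bin o r a a' => .bin o (2 * r + 1) (2 * a + 1) (2 * a' + 1)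
  | .rand r => .rand (2 * r + 1)
  | .load r tbl col row => .load (2 * r + 1) (tbl + 3) col (row.map fun r => 2 * r + 1)
  | .store tbl col row r => .store (tbl + 3) col (row.map fun r => 2 * r + 1) (2 * r + 1)
  | .jump l => .jump (b + min l n)
  | .jumpLt a a' l => .jumpLt (2 * a + 1) (2 * a' + 1) (b + min l n)
  | .jumpEq a a' l => .jumpEq (2 * a + 1) (2 * a' + 1) (b + min l n)
  | .halt => .jump (b + n + 1)

/-- The hosted program `Q`, placed at position `b`.  When `Q` halts, the host continues behind the
last instruction; the additional jump takes the place of the implicit `halt` at the end of `Q`. -/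
def hostCode (Q : Program) (b : ℕ) : List Instr :=
  Q.map (Instr.host b Q.length) ++ [.jump (b + Q.length + 1)]

/-- The configuration of the host that corresponds to a configuration of the hosted program. -/
def hostConfig (b n : ℕ) (s : Store d) (x : Config d) : Config d :=
  ⟨match x.pc with
    | none => some (b + n + 1)
    | some i => some (b + min i n), s.withGuest x.store⟩

lemma Instr.exec_host (c : Instr) {b n i : ℕ} (hi : i < n) (s v : Store d) :
    (c.host b n).exec (b + min i n) (s.withGuest v) = (c.exec i v).map (hostConfig b n s) := by
  have h1 : b + min i n + 1 = b + min (i + 1) n := by omega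
  cases c <;>
    simp only [Instr.host, Instr.exec, PMF.pure_map, hostConfig, withGuest_reg_odd,
      withGuest_setReg, withGuest_setMem, withGuest_addr, withGuest_mem_host, h1, PMF.map_comp,
      Function.comp_def]
  all_goals split_ifs <;> rfl

lemma step_hostConfig {P Q : Program} {b : ℕ} (h : CodeAt P b (hostCode Q b)) (i : ℕ)
    (s v : Store d) :
    step P (hostConfig b Q.length s ⟨some i, v⟩) =
      (step Q ⟨some i, v⟩).map (hostConfig b Q.length s) := by
  rw [hostCode, codeAt_append, List.length_map, codeAt_cons] at h
  obtain ⟨h1, h2, -⟩ := h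
  simp only [step, List.getD_eq_getElem?_getD]
  by_cases hi : i < Q.length
  · have := h1 i (by simpa using hi)
    rw [← Instr.exec_host _ hi]
    simp only [hostConfig]
    rw [show b + min i Q.length = b + i by omega, this]
    simp [hi]
  · simp only [hostConfig]
    rw [show b + min i Q.length = b + Q.length by omega, h2,
      List.getElem?_eq_none (by omega)]
    simp [Instr.exec, PMF.pure_map, hostConfig]

lemma cost_host_le {P Q : Program} {b : ℕ} (h : CodeAt P b (hostCode Q b))
    (G : Store d → ℝ≥0∞) (s v : Store d) :
    cost P G ⟨some b, s.withGuest v⟩ ≤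
      cost Q (fun v' => cost P G ⟨some (b + (Q.length + 1)), s.withGuest v'⟩) (start v) := by
  have key : ∀ n x, costWithin P G n (hostConfig b Q.length s x) ≤ costWithin Q
      (fun v' => cost P G ⟨some (b + (Q.length + 1)), s.withGuest v'⟩) n x := by
    intro n
    induction n with
    | zero => rintro ⟨_ | i, v⟩ <;> simp [costWithin, hostConfig]
    | succ n ih =>
      rintro ⟨_ | i, v⟩
      · refine (costWithin_le_cost P G (n + 1) _).trans (le_of_eq ?_)
        simp [hostConfig, costWithin, add_assoc]
      · simp only [costWithin]
        rw [if_neg (by simp [hostConfig]), if_neg (by simp), step_hostConfig h, expect_map]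
        gcongr
        exact expect_mono _ ih
  refine iSup_le fun n => ?_
  have := (key n (start v)).trans (costWithin_le_cost _ _ n _)
  simpa only [hostConfig, start, Nat.zero_min, Nat.add_zero] using this

end WordRAM

/-! ### Structured programs -/

namespace WordRAM

variable {d : ℕ}

/-- Structured programs.  `op` is meant for instructions that are not jumps; `call Q` runs `Q` as
a hosted program. -/
inductive Cmd
  | skip
  | op (c : Instr)
  | seq (c₁ c₂ : Cmd)
  | ifEq (a b : ℕ) (c₁ c₂ : Cmd)
  | ifLt (a b : ℕ) (c₁ c₂ : Cmd)
  | whileNe (a b : ℕ) (c : Cmd)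
  | call (Q : Program)

/-- The number of instructions of a structured program. -/
def Cmd.len : Cmd → ℕ
  | .skip => 0
  | .op _ => 1
  | .seq c₁ c₂ => c₁.len + c₂.len
  | .ifEq _ _ c₁ c₂ => c₂.len + c₁.len + 2
  | .ifLt _ _ c₁ c₂ => c₂.len + c₁.len + 2
  | .whileNe _ _ c => c.len + 2
  | .call Q => Q.length + 1

/-- The instructions of a structured program that is placed at position `b`.  Control enters at `b`
and leaves at `b + c.len`; for a conditional, the code of the second branch comes first. -/
def Cmd.code : Cmd → ℕ → List Instr
  | .skip, _ => []
  | .op c, _ => [c]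
  | .seq c₁ c₂, b => c₁.code b ++ c₂.code (b + c₁.len)
  | .ifEq x y c₁ c₂, b =>
      .jumpEq x y (b + 1 + c₂.len + 1) :: (c₂.code (b + 1) ++
        (.jump (b + (c₂.len + c₁.len + 2)) :: c₁.code (b + 1 + c₂.len + 1)))
  | .ifLt x y c₁ c₂, b =>
      .jumpLt x y (b + 1 + c₂.len + 1) :: (c₂.code (b + 1) ++
        (.jump (b + (c₂.len + c₁.len + 2)) :: c₁.code (b + 1 + c₂.len + 1)))
  | .whileNe x y c, b => .jumpEq x y (b + (c.len + 2)) :: (c.code (b + 1) ++ [.jump b])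
  | .call Q, b => hostCode Q b

@[simp] lemma Cmd.length_code (c : Cmd) (b : ℕ) : (c.code b).length = c.len := by
  induction c generalizing b with
  | skip => rfl
  | op c => rfl
  | seq c₁ c₂ h₁ h₂ => simp [code, len, h₁, h₂]
  | ifEq x y c₁ c₂ h₁ h₂ => simp [code, len, h₁, h₂]; ring
  | ifLt x y c₁ c₂ h₁ h₂ => simp [code, len, h₁, h₂]; ring
  | whileNe x y c h => simp [code, len, h]
  | call Q => simp [code, len, hostCode]

/-- The largest cost, over all ways to place `c` into a program, of starting at `c` with the store
`s`, when `f` bounds the cost of continuing behind `c`. -/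
noncomputable def Cmd.wp (c : Cmd) (f : Store d → ℝ≥0∞) (s : Store d) : ℝ≥0∞ :=
  ⨆ (P : Program) (b : ℕ) (G : Store d → ℝ≥0∞) (_ : CodeAt P b (c.code b))
    (_ : ∀ s', cost P G ⟨some (b + c.len), s'⟩ ≤ f s'), cost P G ⟨some b, s⟩

namespace Cmd

lemma cost_le_wp {c : Cmd} {f : Store d → ℝ≥0∞} {P : Program} {b : ℕ} {G : Store d → ℝ≥0∞}
    (h : CodeAt P b (c.code b)) (hf : ∀ s', cost P G ⟨some (b + c.len), s'⟩ ≤ f s')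
    (s : Store d) : cost P G ⟨some b, s⟩ ≤ c.wp f s :=
  le_iSup_of_le P <| le_iSup_of_le b <| le_iSup_of_le G <| le_iSup_of_le h <| le_iSup_of_le hf le_rfl

lemma wp_le {c : Cmd} {f : Store d → ℝ≥0∞} {s : Store d} {B : ℝ≥0∞}
    (h : ∀ (P : Program) (b : ℕ) (G : Store d → ℝ≥0∞), CodeAt P b (c.code b) →
      (∀ s', cost P G ⟨some (b + c.len), s'⟩ ≤ f s') → cost P G ⟨some b, s⟩ ≤ B) :
    c.wp f s ≤ B :=
  iSup_le fun P => iSup_le fun b => iSup_le fun G => iSup_le fun hc => iSup_le fun hf =>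
    h P b G hc hf

lemma wp_mono (c : Cmd) {f g : Store d → ℝ≥0∞} (h : ∀ s, f s ≤ g s) (s : Store d) :
    c.wp f s ≤ c.wp g s :=
  wp_le fun _ _ _ hc hf => cost_le_wp hc (fun s' => (hf s').trans (h s')) s

lemma wp_skip (f : Store d → ℝ≥0∞) (s : Store d) : skip.wp f s ≤ f s :=
  wp_le fun _ _ _ _ hf => hf s

lemma wp_op {c : Instr} {s s' : Store d}
    (h : ∀ i, c.exec i s = PMF.pure ⟨some (i + 1), s'⟩) (f : Store d → ℝ≥0∞) :
    (op c).wp f s ≤ 1 + f s' := by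
  refine wp_le fun P b G hc hf => ?_
  rw [code, codeAt_cons] at hc
  exact (cost_le_of_exec hc.1 (h b)).trans (by gcongr; exact hf s')

lemma wp_seq (c₁ c₂ : Cmd) (f : Store d → ℝ≥0∞) (s : Store d) :
    (seq c₁ c₂).wp f s ≤ c₁.wp (c₂.wp f) s := by
  refine wp_le fun P b G hc hf => ?_
  rw [code, codeAt_append, length_code] at hc
  refine cost_le_wp hc.1 (fun s' => cost_le_wp hc.2 (fun s'' => ?_) s') s
  rw [add_assoc]; exact hf s''

/-- The common part of the rules for `ifEq` and `ifLt`: `j` is the conditional jump. -/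
lemma cost_branch_le {P : Program} {b : ℕ} {G : Store d → ℝ≥0∞} {f : Store d → ℝ≥0∞}
    {c₁ c₂ : Cmd} {s : Store d} {j : Instr} {t : Prop} [Decidable t]
    (hj : j.exec b s = PMF.pure ⟨some (if t then b + 1 + c₂.len + 1 else b + 1), s⟩)
    (hc : CodeAt P b (j :: (c₂.code (b + 1) ++
        (.jump (b + (c₂.len + c₁.len + 2)) :: c₁.code (b + 1 + c₂.len + 1)))))
    (hf : ∀ s', cost P G ⟨some (b + (c₂.len + c₁.len + 2)), s'⟩ ≤ f s') :
    cost P G ⟨some b, s⟩ ≤ 1 + if t then c₁.wp f s else c₂.wp (fun s' => 1 + f s') s := by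
  rw [codeAt_cons, codeAt_append, codeAt_cons, length_code] at hc
  obtain ⟨h1, h2, h3, h4⟩ := hc
  refine (cost_le_of_exec h1 hj).trans ?_
  gcongr
  split_ifs with ht
  · refine cost_le_wp h4 (fun s' => ?_) s
    rw [show b + 1 + c₂.len + 1 + c₁.len = b + (c₂.len + c₁.len + 2) by ring]
    exact hf s'
  · refine cost_le_wp h2 (fun s' => ?_) s
    refine (cost_le_of_exec h3 rfl).trans ?_
    gcongr
    exact hf s'

lemma wp_ifEq (a b : ℕ) (c₁ c₂ : Cmd) (f : Store d → ℝ≥0∞) (s : Store d) :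
    (ifEq a b c₁ c₂).wp f s ≤
      1 + if s.reg a = s.reg b then c₁.wp f s else c₂.wp (fun s' => 1 + f s') s :=
  wp_le fun _ _ _ hc hf => cost_branch_le rfl hc hf

lemma wp_ifLt (a b : ℕ) (c₁ c₂ : Cmd) (f : Store d → ℝ≥0∞) (s : Store d) :
    (ifLt a b c₁ c₂).wp f s ≤
      1 + if (s.reg a).toNat < (s.reg b).toNat then c₁.wp f s
        else c₂.wp (fun s' => 1 + f s') s :=
  wp_le fun _ _ _ hc hf => cost_branch_le rfl hc hf

lemma wp_whileNe (a b : ℕ) (c : Cmd) (f : Store d → ℝ≥0∞) (s : Store d) :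
    (whileNe a b c).wp f s ≤
      1 + if s.reg a = s.reg b then f s
        else c.wp (fun s' => 1 + (whileNe a b c).wp f s') s := by
  refine wp_le fun P l G hc hf => ?_
  have hc' := hc
  rw [code, codeAt_cons, codeAt_append, codeAt_cons, length_code] at hc
  obtain ⟨h1, h2, h3, -⟩ := hc
  refine (cost_le_of_exec h1 rfl).trans ?_
  gcongr
  split_ifs with ht
  · exact hf s
  · refine cost_le_wp h2 (fun s' => ?_) s
    refine (cost_le_of_exec h3 rfl).trans ?_
    gcongr
    exact cost_le_wp hc' hf s'

lemma wp_call (Q : Program) (f : Store d → ℝ≥0∞) (s : Store d) :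
    (call Q).wp f s ≤
      expectedTime Q s.guest + ∑' v, finalMass Q s.guest v * f (s.withGuest v) := by
  refine wp_le fun P b G hc hf => ?_
  have h := cost_host_le hc G s s.guest
  rw [withGuest_guest] at h
  refine (h.trans (cost_start_le _ _ _)).trans ?_
  gcongr with v
  exact hf _

/-- Behind the last instruction the machine halts, which takes one more step. -/
lemma cost_code_le (c : Cmd) (G : Store d → ℝ≥0∞) (s : Store d) :
    cost (c.code 0) G (start s) ≤ c.wp (fun s' => 1 + G s') s := by
  refine cost_le_wp (fun i _ => by simp) (fun s' => ?_) s
  refine (cost_some_le _ _ _ _).trans ?_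
  rw [List.getD_eq_getElem?_getD, List.getElem?_eq_none (by simp)]
  simp [Instr.exec, expect_pure, cost_none]

/-! ### Deterministic parts -/

/-- Started with the store `s`, the structured program `c` takes at most `t` steps and ends with
the store `s'`.  This is stated as an upper bound for costs, which is all that the analysis needs. -/
def Det (c : Cmd) (s : Store d) (t : ℕ) (s' : Store d) : Prop :=
  ∀ f : Store d → ℝ≥0∞, c.wp f s ≤ t + f s'

lemma Det.mono {c : Cmd} {s s' : Store d} {t t' : ℕ} (h : Det c s t s') (ht : t ≤ t') :
    Det c s t' s' := fun f => (h f).trans (by gcongr)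

lemma Det.skip (s : Store d) : Det .skip s 0 s := fun f => by simpa using wp_skip f s

lemma Det.op {c : Instr} {s s' : Store d} (h : ∀ i, c.exec i s = PMF.pure ⟨some (i + 1), s'⟩) :
    Det (.op c) s 1 s' := fun f => by simpa using wp_op h f

lemma Det.seq {c₁ c₂ : Cmd} {s s₁ s₂ : Store d} {t₁ t₂ : ℕ} (h₁ : Det c₁ s t₁ s₁)
    (h₂ : Det c₂ s₁ t₂ s₂) : Det (.seq c₁ c₂) s (t₁ + t₂) s₂ := fun f => by
  refine (wp_seq _ _ _ _).trans ((h₁ _).trans ?_)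
  push_cast; rw [add_assoc]; gcongr; exact h₂ f

lemma Det.ifEq {a b : ℕ} {c₁ c₂ : Cmd} {s s' : Store d} {t : ℕ}
    (h₁ : s.reg a = s.reg b → Det c₁ s t s') (h₂ : s.reg a ≠ s.reg b → Det c₂ s t s') :
    Det (.ifEq a b c₁ c₂) s (t + 2) s' := fun f => by
  refine (wp_ifEq _ _ _ _ _ _).trans ?_
  push_cast
  split_ifs with h
  · refine (add_le_add le_rfl (h₁ h f)).trans ?_
    rw [← add_assoc, add_comm 1 (t : ℝ≥0∞)]
    gcongr
    exact one_le_two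
  · refine (add_le_add le_rfl (h₂ h _)).trans (le_of_eq ?_)
    rw [← one_add_one_eq_two]; ring

lemma Det.ifLt {a b : ℕ} {c₁ c₂ : Cmd} {s s' : Store d} {t : ℕ}
    (h₁ : (s.reg a).toNat < (s.reg b).toNat → Det c₁ s t s')
    (h₂ : ¬ (s.reg a).toNat < (s.reg b).toNat → Det c₂ s t s') :
    Det (.ifLt a b c₁ c₂) s (t + 2) s' := fun f => by
  refine (wp_ifLt _ _ _ _ _ _).trans ?_
  push_cast
  split_ifs with h
  · refine (add_le_add le_rfl (h₁ h f)).trans ?_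
    rw [← add_assoc, add_comm 1 (t : ℝ≥0∞)]
    gcongr
    exact one_le_two
  · refine (add_le_add le_rfl (h₂ h _)).trans (le_of_eq ?_)
    rw [← one_add_one_eq_two]; ring

/-- The commands `c 0, …, c (n - 1)` one after the other. -/
def forN (c : ℕ → Cmd) : ℕ → Cmd
  | 0 => .skip
  | n + 1 => .seq (forN c n) (c n)

lemma Det.forN {c : ℕ → Cmd} {n t : ℕ} (F : ℕ → Store d)
    (h : ∀ j < n, Det (c j) (F j) t (F (j + 1))) : Det (forN c n) (F 0) (n * t) (F n) := by
  induction n with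
  | zero => rw [zero_mul]; exact Det.skip (F 0)
  | succ n ih =>
    rw [add_mul, one_mul]
    exact (ih fun j hj => h j (by omega)).seq (h n (by omega))

end Cmd

end WordRAM

/-! ### Words of numbers -/

namespace WordRAM

variable {d : ℕ}

lemma toNat_numWord (d v j : ℕ) : (numWord d v j).toNat = v / 2 ^ (d * j) % 2 ^ d := by
  simp [numWord]

lemma numWord_zero_left (d j : ℕ) : numWord d 0 j = 0 := by simp [numWord]

lemma numWord_succ (d v j : ℕ) : numWord d v (j + 1) = numWord d (v / 2 ^ d) j := by
  simp only [numWord, Nat.div_div_eq_div_mul]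
  congr 2
  rw [← pow_add]; congr 1; ring

lemma numWord_eq_zero {d v n j : ℕ} (h : v < 2 ^ (d * n)) (hj : n ≤ j) : numWord d v j = 0 := by
  have : v / 2 ^ (d * j) = 0 :=
    Nat.div_eq_of_lt (h.trans_le (Nat.pow_le_pow_right (by norm_num) (Nat.mul_le_mul_left d hj)))
  simp [numWord, this]

/-- Splitting off the most significant of `j + 1` words. -/
lemma mod_pow_mul_succ (d v j : ℕ) :
    v % 2 ^ (d * (j + 1)) = v % 2 ^ (d * j) + 2 ^ (d * j) * (numWord d v j).toNat := by
  rw [toNat_numWord, mul_add, mul_one, pow_add, Nat.mod_mul]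

/-- A sum of words at their places is the number with these words. -/
lemma sum_words_eq (d n : ℕ) (w : ℕ → BitVec d) :
    ∑ j ∈ Finset.range n, (w j).toNat * 2 ^ (d * j) < 2 ^ (d * n) ∧
      ∀ j < n, numWord d (∑ j ∈ Finset.range n, (w j).toNat * 2 ^ (d * j)) j = w j := by
  induction n with
  | zero => simp
  | succ n ih =>
    rw [Finset.sum_range_succ]
    set x := ∑ j ∈ Finset.range n, (w j).toNat * 2 ^ (d * j)
    have hw := (w n).isLt
    have hpos : 0 < 2 ^ (d * n) := by positivity
    constructor
    · rw [mul_add, mul_one, pow_add]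
      have h2 : ((w n).toNat + 1) * 2 ^ (d * n) ≤ 2 ^ d * 2 ^ (d * n) :=
        Nat.mul_le_mul_right _ hw
      rw [add_mul, one_mul] at h2
      calc x + (w n).toNat * 2 ^ (d * n) < 2 ^ (d * n) + (w n).toNat * 2 ^ (d * n) := by
            have := ih.1; omega
        _ ≤ 2 ^ (d * n) * 2 ^ d := by rw [add_comm, mul_comm (2 ^ (d * n))]; exact h2
    · intro j hj
      apply BitVec.eq_of_toNat_eq
      rw [toNat_numWord]
      rcases Nat.lt_succ_iff_lt_or_eq.1 hj with h | rfl
      · rw [← ih.2 j h, toNat_numWord]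
        obtain ⟨m, rfl⟩ := Nat.exists_eq_add_of_lt h
        have : (w (j + m + 1)).toNat * 2 ^ (d * (j + m + 1)) =
            2 ^ (d * j) * (2 ^ d * ((w (j + m + 1)).toNat * 2 ^ (d * m))) := by
          rw [mul_add, mul_add, pow_add, pow_add]; ring
        rw [this, Nat.add_mul_div_left _ _ (by positivity), Nat.add_mul_mod_self_left]
      · rw [Nat.add_mul_div_right _ _ hpos, Nat.div_eq_of_lt ih.1, zero_add,
          Nat.mod_eq_of_lt hw]

lemma sum_numWord {d v n : ℕ} (h : v < 2 ^ (d * n)) :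
    ∑ j ∈ Finset.range n, (numWord d v j).toNat * 2 ^ (d * j) = v := by
  suffices ∀ n, ∑ j ∈ Finset.range n, (numWord d v j).toNat * 2 ^ (d * j) = v % 2 ^ (d * n) by
    rw [this, Nat.mod_eq_of_lt h]
  intro n
  induction n with
  | zero => simp [Nat.mod_one]
  | succ n ih => rw [Finset.sum_range_succ, ih, mod_pow_mul_succ, mul_comm (2 ^ (d * n))]

lemma readNum_eq_iff {s : Store d} {tbl n v : ℕ} {row : List (BitVec d)} (h : v < 2 ^ (d * n)) :
    s.readNum tbl n row = v ↔ ∀ j < n, s.mem ⟨tbl, j, row⟩ = numWord d v j := by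
  unfold Store.readNum
  constructor
  · rintro rfl j hj
    exact ((sum_words_eq d n fun j => s.mem ⟨tbl, j, row⟩).2 j hj).symm
  · intro hw
    rw [← sum_numWord h]
    exact Finset.sum_congr rfl fun j hj => by rw [hw j (Finset.mem_range.1 hj)]

lemma readNum_lt (s : Store d) (tbl n : ℕ) (row : List (BitVec d)) :
    s.readNum tbl n row < 2 ^ (d * n) :=
  (sum_words_eq d n fun j => s.mem ⟨tbl, j, row⟩).1

@[simp] lemma length_rowOf (d c i : ℕ) : (rowOf d c i).length = c := by simp [rowOf]

lemma rowVal_eq_sum (row : List (BitVec d)) :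
    rowVal row = ∑ j ∈ Finset.range row.length, (row.getD j 0).toNat * 2 ^ (d * j) := by
  induction row with
  | nil => simp [rowVal]
  | cons x row ih =>
    have : rowVal (x :: row) = x.toNat + 2 ^ d * rowVal row := by simp [rowVal, Nat.ofDigits_cons]
    rw [this, List.length_cons, Finset.sum_range_succ', ih, Finset.mul_sum, add_comm]
    congr 1
    · refine Finset.sum_congr rfl fun j _ => ?_
      rw [mul_add, pow_add]; simp; ring
    · simp

lemma rowVal_rowOf {d c i : ℕ} (h : i < 2 ^ (d * c)) : rowVal (rowOf d c i) = i := by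
  rw [rowVal_eq_sum, length_rowOf, ← sum_numWord h]
  refine Finset.sum_congr rfl fun j hj => ?_
  have := Finset.mem_range.1 hj
  rw [sum_numWord h]
  simp [rowOf, this]

lemma rowOf_rowVal (row : List (BitVec d)) : rowOf d row.length (rowVal row) = row := by
  refine List.ext_getElem (by simp) fun j h1 h2 => ?_
  simp only [rowOf, List.getElem_map, List.getElem_range]
  rw [rowVal_eq_sum, (sum_words_eq d _ _).2 j h2]
  simp [h2]

lemma rowOf_inj {d c i j : ℕ} (hi : i < 2 ^ (d * c)) (hj : j < 2 ^ (d * c))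
    (h : rowOf d c i = rowOf d c j) : i = j := by
  rw [← rowVal_rowOf hi, h, rowVal_rowOf hj]

lemma numWord_add_mul_of_lt {d c i a j : ℕ} (h : j < c) :
    numWord d (i + 2 ^ (d * c) * a) j = numWord d i j := by
  apply BitVec.eq_of_toNat_eq
  obtain ⟨m, rfl⟩ := Nat.exists_eq_add_of_lt h
  rw [toNat_numWord, toNat_numWord]
  have : 2 ^ (d * (j + m + 1)) * a = 2 ^ (d * j) * (2 ^ d * (2 ^ (d * m) * a)) := by
    rw [mul_add, mul_add, pow_add, pow_add]; ring
  rw [this, Nat.add_mul_div_left _ _ (by positivity), Nat.add_mul_mod_self_left]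

lemma numWord_add_mul_of_le {d c i a : ℕ} (hi : i < 2 ^ (d * c)) (j : ℕ) :
    numWord d (i + 2 ^ (d * c) * a) (c + j) = numWord d a j := by
  unfold numWord
  rw [mul_add, pow_add, ← Nat.div_div_eq_div_mul, Nat.add_mul_div_left _ _ (by positivity),
    Nat.div_eq_of_lt hi, zero_add]

lemma numWord_sub_one {y : ℕ} (hy : y ≠ 0) : numWord d (y - 1) 0 = numWord d y 0 - 1 := by
  obtain ⟨z, rfl⟩ := Nat.exists_eq_succ_of_ne_zero hy
  have : numWord d z.succ 0 = numWord d z 0 + 1 := by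
    simp [numWord, BitVec.ofNat_add]
  rw [this, BitVec.add_sub_cancel]; rfl

lemma sub_one_div_of_dvd {y m : ℕ} (hm : 0 < m) (h : y % m = 0) : (y - 1) / m = y / m - 1 := by
  obtain ⟨q, rfl⟩ := Nat.dvd_of_mod_eq_zero h
  rw [Nat.mul_div_cancel_left _ hm]
  cases q with
  | zero => simp
  | succ q =>
    refine Nat.div_eq_of_lt_le ?_ ?_
    · rw [Nat.add_sub_cancel, mul_add, mul_comm q]; omega
    · rw [Nat.add_sub_cancel, mul_comm _ m]
      have : 0 < m * (q + 1) := by positivity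
      omega

lemma sub_one_div_of_not_dvd {y m : ℕ} (hm : 0 < m) (h : y % m ≠ 0) : (y - 1) / m = y / m := by
  have h1 := Nat.div_add_mod y m
  have h2 := Nat.mod_lt y hm
  refine Nat.div_eq_of_lt_le ?_ ?_
  · rw [mul_comm]; omega
  · rw [add_mul, one_mul, mul_comm]; omega

lemma numWord_zero_right_eq_zero_iff {y : ℕ} : numWord d y 0 = 0 ↔ y % 2 ^ d = 0 := by
  rw [← BitVec.toNat_inj, toNat_numWord]; simp

lemma eq_of_add_mul_eq {M x y x' y' : ℕ} (hx : x < M) (hx' : x' < M)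
    (h : x + M * y = x' + M * y') : x = x' ∧ y = y' := by
  have h1 := congrArg (· % M) h
  have h2 := congrArg (· / M) h
  simp only [Nat.add_mul_mod_self_left, Nat.mod_eq_of_lt hx, Nat.mod_eq_of_lt hx'] at h1
  simp only [Nat.add_mul_div_left _ _ (show 0 < M by omega), Nat.div_eq_of_lt hx,
    Nat.div_eq_of_lt hx', zero_add] at h2
  exact ⟨h1, h2⟩

lemma add_mul_lt_add_mul_iff {M x y x' y' : ℕ} (hx : x < M) (hx' : x' < M) :
    x + M * y < x' + M * y' ↔ y < y' ∨ (y = y' ∧ x < x') := by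
  rcases lt_trichotomy y y' with h | rfl | h
  · have : M * (y + 1) ≤ M * y' := Nat.mul_le_mul_left _ h
    rw [mul_add, mul_one] at this
    simp only [h, true_or, iff_true]; omega
  · simp
  · have : M * (y' + 1) ≤ M * y := Nat.mul_le_mul_left _ h
    rw [mul_add, mul_one] at this
    constructor
    · intro; omega
    · intro; omega

/-! ### Register groups and rows of cells -/

/-- The `j`-th register of the group `g`, for `g < 8`; each group is infinite.  All these registers
are even, so they do not meet those of a hosted program. -/
def slot (g j : ℕ) : ℕ := 2 * (8 * j + g)

/-- The register that holds zero. -/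
abbrev rZero : ℕ := slot 0 0

/-- The register that holds one. -/
abbrev rOne : ℕ := slot 0 1

/-- The register that holds the result of the last comparison or decrement. -/
abbrev rFlag : ℕ := slot 0 2

/-- The register that holds the greatest word. -/
abbrev rOnes : ℕ := slot 0 3

/-- The register that holds half of the greatest word, rounded down. -/
abbrev rHalf : ℕ := slot 0 4

/-- The first `n` registers of the group `g`. -/
def slots (g n : ℕ) : List ℕ := (List.range n).map (slot g)

namespace Store

/-- Set the first `n` registers of the group `g`. -/
def setArr (s : Store d) (g n : ℕ) (w : ℕ → BitVec d) : Store d :=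
  { s with reg := fun r => if r % 16 = 2 * g ∧ r / 16 < n then w (r / 16) else s.reg r }

open Classical in
/-- Set the first `n` columns of a row of a table. -/
noncomputable def setRow (s : Store d) (tbl n : ℕ) (row : List (BitVec d)) (w : ℕ → BitVec d) :
    Store d :=
  { s with mem := fun a =>
      if a.tbl = tbl ∧ a.col < n ∧ a.row = row then w a.col else s.mem a }

variable (s : Store d)

lemma setReg_slot (g j g' j' : ℕ) (hg : g < 8) (hg' : g' < 8) (w : BitVec d) :
    (s.setReg (slot g j) w).reg (slot g' j') =
      if g' = g ∧ j' = j then w else s.reg (slot g' j') := by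
  simp only [setReg, slot]
  congr 1
  simp only [eq_iff_iff]; omega

lemma setArr_slot (g n g' j' : ℕ) (hg : g < 8) (hg' : g' < 8) (w : ℕ → BitVec d) :
    (s.setArr g n w).reg (slot g' j') =
      if g' = g ∧ j' < n then w j' else s.reg (slot g' j') := by
  simp only [setArr, slot]
  rw [show 2 * (8 * j' + g') / 16 = j' by omega]
  congr 1
  simp only [eq_iff_iff]; omega

@[simp] lemma setArr_mem (g n : ℕ) (w : ℕ → BitVec d) : (s.setArr g n w).mem = s.mem := rfl

open Classical in
lemma setRow_mem (tbl n : ℕ) (row : List (BitVec d)) (w : ℕ → BitVec d) (a : Addr d) :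
    (s.setRow tbl n row w).mem a =
      if a.tbl = tbl ∧ a.col < n ∧ a.row = row then w a.col else s.mem a := rfl

@[simp] lemma setReg_guest (g j : ℕ) (w : BitVec d) : (s.setReg (slot g j) w).guest = s.guest := by
  refine Store.ext (funext fun r => ?_) rfl
  exact if_neg (by simp only [slot]; omega)

@[simp] lemma setArr_guest (g n : ℕ) (w : ℕ → BitVec d) : (s.setArr g n w).guest = s.guest := by
  refine Store.ext (funext fun r => ?_) rfl
  simp only [guest, setArr]
  rw [if_neg (by omega)]

lemma setRow_guest_of_lt {tbl : ℕ} (h : tbl < 3) (n : ℕ) (row : List (BitVec d))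
    (w : ℕ → BitVec d) : (s.setRow tbl n row w).guest = s.guest := by
  refine Store.ext rfl (funext fun a => ?_)
  simp only [guest, setRow, Addr.host]
  rw [if_neg (by omega)]

@[simp] lemma setRow_guest (tbl n : ℕ) (row : List (BitVec d)) (w : ℕ → BitVec d) :
    (s.setRow (tbl + 3) n row w).guest = s.guest.setRow tbl n row w := by
  refine Store.ext rfl (funext fun a => ?_)
  simp [guest, setRow, Addr.host]

lemma writeNum_eq (tbl n v : ℕ) : s.writeNum tbl n v = s.setRow tbl n [] (numWord d v) := by
  refine Store.ext rfl (funext fun a => ?_)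
  simp [writeNum, setRow]

@[simp] lemma withGuest_reg_slot (v : Store d) (g j : ℕ) :
    (s.withGuest v).reg (slot g j) = s.reg (slot g j) := withGuest_reg_even s v _

lemma withGuest_mem_of_lt (v : Store d) {a : Addr d} (h : a.tbl < 3) :
    (s.withGuest v).mem a = s.mem a := by
  simp only [Store.withGuest]; rw [if_neg (by omega)]

/-- The constants are in their registers. -/
structure Consts : Prop where
  zero : s.reg rZero = 0
  one : s.reg rOne = 1
  ones : s.reg rOnes = BitVec.allOnes d
  half : s.reg rHalf = BitVec.allOnes d >>> (1 : BitVec d)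

/-- The first `n` registers of the group `g` hold the words of `v`. -/
def Holds (g n v : ℕ) : Prop := ∀ j < n, s.reg (slot g j) = numWord d v j

variable {s}

lemma Holds.map_slots {g n v : ℕ} (h : s.Holds g n v) : (slots g n).map s.reg = rowOf d n v := by
  simp only [slots, rowOf, List.map_map]
  exact List.map_congr_left fun j hj => h j (List.mem_range.1 hj)

lemma Consts.congr {s' : Store d} (h : s.Consts)
    (hs : ∀ j, j ≠ 2 → s'.reg (slot 0 j) = s.reg (slot 0 j)) : s'.Consts :=
  ⟨(hs 0 (by simp)).trans h.zero, (hs 1 (by simp)).trans h.one, (hs 3 (by simp)).trans h.ones,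
    (hs 4 (by simp)).trans h.half⟩

end Store

end WordRAM

/-! ### Multi-word operations and counting loops -/

namespace WordRAM

variable {d : ℕ}

namespace Store

variable (s : Store d)

@[simp] lemma setArr_zero (g : ℕ) (w : ℕ → BitVec d) : s.setArr g 0 w = s := by
  simp [setArr]

lemma setArr_succ (g j : ℕ) (hg : g < 8) (w : ℕ → BitVec d) :
    (s.setArr g j w).setReg (slot g j) (w j) = s.setArr g (j + 1) w := by
  refine Store.ext (funext fun r => ?_) rfl
  have hr : r = slot g j ↔ r % 16 = 2 * g ∧ r / 16 = j := by simp only [slot]; omega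
  simp only [setArr, setReg]
  by_cases h₁ : r = slot g j
  · rw [if_pos h₁, if_pos (by rw [hr] at h₁; omega), (hr.1 h₁).2]
  · rw [if_neg h₁]
    rw [hr] at h₁
    by_cases h₂ : r % 16 = 2 * g ∧ r / 16 < j
    · rw [if_pos h₂, if_pos (by omega)]
    · rw [if_neg h₂, if_neg (by omega)]

@[simp] lemma setRow_zero (tbl : ℕ) (row : List (BitVec d)) (w : ℕ → BitVec d) :
    s.setRow tbl 0 row w = s := by
  simp [setRow]

lemma setRow_succ (tbl j : ℕ) (row : List (BitVec d)) (w : ℕ → BitVec d) :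
    (s.setRow tbl j row w).setMem ⟨tbl, j, row⟩ (w j) = s.setRow tbl (j + 1) row w := by
  refine Store.ext rfl (funext fun a => ?_)
  have ha : a = ⟨tbl, j, row⟩ ↔ a.tbl = tbl ∧ a.col = j ∧ a.row = row := by rw [Addr.ext_iff]
  simp only [setMem, setRow]
  by_cases h₁ : a = ⟨tbl, j, row⟩
  · have h₂ := ha.1 h₁
    rw [if_pos h₁, if_pos ⟨h₂.1, by omega, h₂.2.2⟩, h₂.2.1]
  · rw [if_neg h₁]
    by_cases h₂ : a.tbl = tbl ∧ a.col < j ∧ a.row = row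
    · rw [if_pos h₂, if_pos ⟨h₂.1, by omega, h₂.2.2⟩]
    · rw [if_neg h₂, if_neg]
      rintro ⟨h₃, h₄, h₅⟩
      have h₆ : a.col ≠ j := fun h => h₁ (ha.2 ⟨h₃, h, h₅⟩)
      exact h₂ ⟨h₃, by omega, h₅⟩

lemma setRow_congr {s : Store d} {tbl n : ℕ} {row : List (BitVec d)} {v w : ℕ → BitVec d}
    (h : ∀ j < n, v j = w j) : s.setRow tbl n row v = s.setRow tbl n row w := by
  refine Store.ext rfl (funext fun a => ?_)
  simp only [setRow_mem]
  split_ifs with ha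
  · exact h _ ha.2.1
  · rfl

lemma map_slots_setArr {g g' : ℕ} (c j : ℕ) (hg : g < 8) (hg' : g' < 8) (h : g' ≠ g)
    (w : ℕ → BitVec d) : (slots g' c).map (s.setArr g j w).reg = (slots g' c).map s.reg := by
  refine List.map_congr_left fun r hr => ?_
  obtain ⟨i, -, rfl⟩ := List.mem_map.1 hr
  rw [setArr_slot _ _ _ _ _ hg hg', if_neg (by tauto)]

lemma setReg_self (r : ℕ) : s.setReg r (s.reg r) = s := by
  refine Store.ext (funext fun r' => ?_) rfl
  simp only [setReg]; split_ifs with h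
  · rw [h]
  · rfl

lemma setReg_setReg (r : ℕ) (v w : BitVec d) : (s.setReg r v).setReg r w = s.setReg r w := by
  refine Store.ext (funext fun r' => ?_) rfl
  simp only [setReg]; split_ifs <;> rfl

lemma Holds.congr {s s' : Store d} {g n v : ℕ} (h : s.Holds g n v)
    (hs : ∀ j < n, s'.reg (slot g j) = s.reg (slot g j)) : s'.Holds g n v :=
  fun j hj => (hs j hj).trans (h j hj)

end Store

namespace Cmd

lemma Det.const (s : Store d) (r v : ℕ) :
    Det (.op (.const r v)) s 1 (s.setReg r (BitVec.ofNat d v)) := Det.op fun _ => rfl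

lemma Det.copy (s : Store d) (r a : ℕ) :
    Det (.op (.copy r a)) s 1 (s.setReg r (s.reg a)) := Det.op fun _ => rfl

lemma Det.un (s : Store d) (o : UnOp) (r a : ℕ) :
    Det (.op (.un o r a)) s 1 (s.setReg r (o.eval (s.reg a))) := Det.op fun _ => rfl

lemma Det.bin (s : Store d) (o : BinOp) (r a b : ℕ) :
    Det (.op (.bin o r a b)) s 1 (s.setReg r (o.eval (s.reg a) (s.reg b))) := Det.op fun _ => rfl

/-- Load the first `n` columns of a row of a table into the group `g`. -/
def loadArr (g n tbl : ℕ) (row : List ℕ) : Cmd := forN (fun j => .op (.load (slot g j) tbl j row)) n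

lemma Det.loadArr {s : Store d} {g : ℕ} (hg : g < 8) (n tbl : ℕ) {row : List ℕ}
    (hrow : ∀ j w, row.map (s.setArr g j w).reg = row.map s.reg) :
    Det (loadArr g n tbl row) s n (s.setArr g n fun j => s.mem ⟨tbl, j, row.map s.reg⟩) := by
  have := Det.forN (c := fun j => .op (.load (slot g j) tbl j row)) (n := n) (t := 1)
    (fun m => s.setArr g m fun j => s.mem ⟨tbl, j, row.map s.reg⟩) fun j _ => by
      rw [← Store.setArr_succ _ _ _ hg]
      refine Det.op fun i => ?_
      simp only [Instr.exec, Store.addr, hrow, Store.setArr_mem]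
  rw [mul_one, Store.setArr_zero] at this
  exact this

/-- Store the registers `ρ 0, …, ρ (n - 1)` into the first `n` columns of a row of a table. -/
def storeRow (tbl n : ℕ) (row : List ℕ) (ρ : ℕ → ℕ) : Cmd :=
  forN (fun j => .op (.store tbl j row (ρ j))) n

lemma Det.storeRow (s : Store d) (tbl n : ℕ) (row : List ℕ) (ρ : ℕ → ℕ) :
    Det (storeRow tbl n row ρ) s n (s.setRow tbl n (row.map s.reg) fun j => s.reg (ρ j)) := by
  have := Det.forN (c := fun j => .op (.store tbl j row (ρ j))) (n := n) (t := 1)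
    (fun m => s.setRow tbl m (row.map s.reg) fun j => s.reg (ρ j)) fun j _ => by
      rw [← Store.setRow_succ]
      exact Det.op fun i => rfl
  rw [mul_one, Store.setRow_zero] at this
  exact this

/-- Copy the first `n` registers of the group `g'` to the group `g`. -/
def copyArr (g g' n : ℕ) : Cmd := forN (fun j => .op (.copy (slot g j) (slot g' j))) n

lemma Det.copyArr (s : Store d) {g g' : ℕ} (hg : g < 8) (hg' : g' < 8) (h : g' ≠ g) (n : ℕ) :
    Det (copyArr g g' n) s n (s.setArr g n fun j => s.reg (slot g' j)) := by
  have := Det.forN (c := fun j => .op (.copy (slot g j) (slot g' j))) (n := n) (t := 1)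
    (fun m => s.setArr g m fun j => s.reg (slot g' j)) fun j _ => by
      rw [← Store.setArr_succ _ _ _ hg]
      refine Det.op fun i => ?_
      simp only [Instr.exec]
      rw [Store.setArr_slot _ _ _ _ _ hg hg', if_neg (by tauto)]
  rw [mul_one, Store.setArr_zero] at this
  exact this

/-- Compare the `n`-word numbers in the groups `g` and `g'`.  Afterwards the flag tells whether the
first one is smaller; if they are equal, the flag keeps its value. -/
def compare (g g' n : ℕ) : Cmd :=
  forN (fun j => .ifLt (slot g j) (slot g' j) (.op (.copy rFlag rOne))
    (.ifLt (slot g' j) (slot g j) (.op (.copy rFlag rZero)) .skip)) n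

/-- One step of a comparison that starts with the least significant words: a more significant word
overrules the result so far, unless it is the same in both numbers. -/
lemma lt_iff_of_words (d x y j : ℕ) (b : Prop) :
    (x % 2 ^ (d * (j + 1)) < y % 2 ^ (d * (j + 1)) ∨
        (x % 2 ^ (d * (j + 1)) = y % 2 ^ (d * (j + 1)) ∧ b)) ↔
      (numWord d x j).toNat < (numWord d y j).toNat ∨
        ((numWord d x j).toNat = (numWord d y j).toNat ∧
          (x % 2 ^ (d * j) < y % 2 ^ (d * j) ∨ (x % 2 ^ (d * j) = y % 2 ^ (d * j) ∧ b))) := by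
  rw [mod_pow_mul_succ, mod_pow_mul_succ]
  have hm : 0 < 2 ^ (d * j) := by positivity
  have hx := Nat.mod_lt x hm
  have hy := Nat.mod_lt y hm
  generalize x % 2 ^ (d * j) = x' at *
  generalize y % 2 ^ (d * j) = y' at *
  generalize (numWord d x j).toNat = u at *
  generalize (numWord d y j).toNat = v at *
  generalize 2 ^ (d * j) = m at *
  rcases lt_trichotomy u v with h | rfl | h
  · have : m * (u + 1) ≤ m * v := Nat.mul_le_mul_left _ h
    rw [mul_add, mul_one] at this
    simp only [h, true_or, iff_true]; left; omega
  · simp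
  · have : m * (v + 1) ≤ m * u := Nat.mul_le_mul_left _ h
    rw [mul_add, mul_one] at this
    have h1 : ¬ (x' + m * u < y' + m * v) := by omega
    have h2 : ¬ (x' + m * u = y' + m * v) := by omega
    have h3 : ¬ u < v := by omega
    have h4 : ¬ u = v := by omega
    simp only [h1, h2, h3, h4, false_and, or_false]

open Classical in
/-- The truth value of a proposition as a word. -/
noncomputable def flagWord (d : ℕ) (b : Prop) : BitVec d := if b then 1 else 0

lemma Det.compare {s : Store d} {g g' n x y : ℕ} (hg : 0 < g) (hg8 : g < 8) (hg' : 0 < g')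
    (hg8' : g' < 8) (hc : s.Consts) (hx : s.Holds g n x) (hy : s.Holds g' n y)
    (hxn : x < 2 ^ (d * n)) (hyn : y < 2 ^ (d * n)) {b : Prop} (hb : s.reg rFlag = flagWord d b) :
    Det (compare g g' n) s (n * 5) (s.setReg rFlag (flagWord d (x < y ∨ (x = y ∧ b)))) := by
  have := Det.forN (c := fun j => .ifLt (slot g j) (slot g' j) (.op (.copy rFlag rOne))
    (.ifLt (slot g' j) (slot g j) (.op (.copy rFlag rZero)) .skip)) (n := n) (t := 5)
    (fun j => s.setReg rFlag (flagWord d (x % 2 ^ (d * j) < y % 2 ^ (d * j) ∨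
      (x % 2 ^ (d * j) = y % 2 ^ (d * j) ∧ b)))) fun j hj => by
      rw [lt_iff_of_words]
      set s' := s.setReg rFlag (flagWord d (x % 2 ^ (d * j) < y % 2 ^ (d * j) ∨
        (x % 2 ^ (d * j) = y % 2 ^ (d * j) ∧ b))) with hs'
      have h1 : s'.reg (slot g j) = numWord d x j := by
        rw [hs', Store.setReg_slot _ _ _ _ _ (by omega) hg8, if_neg (by omega), hx j hj]
      have h2 : s'.reg (slot g' j) = numWord d y j := by
        rw [hs', Store.setReg_slot _ _ _ _ _ (by omega) hg8', if_neg (by omega), hy j hj]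
      have h3 : s'.reg rOne = 1 := by
        rw [hs', Store.setReg_slot _ _ _ _ _ (by omega) (by omega), if_neg (by omega), hc.one]
      have h4 : s'.reg rZero = 0 := by
        rw [hs', Store.setReg_slot _ _ _ _ _ (by omega) (by omega), if_neg (by omega), hc.zero]
      refine Det.ifLt (t := 3) (fun h => ?_) fun h => Det.ifLt (t := 1) (fun h' => ?_) fun h' => ?_
      · rw [h1, h2] at h
        simp only [h, true_or]
        have ht := (Det.copy s' rFlag rOne).mono (t' := 3) (by norm_num)
        have he : s'.setReg rFlag 1 = s.setReg rFlag 1 := by rw [hs', Store.setReg_setReg]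
        rw [h3, he] at ht
        rw [show flagWord d True = 1 from if_pos trivial]
        exact ht
      · rw [h1, h2] at h'
        have h5 : ¬ (numWord d x j).toNat < (numWord d y j).toNat := by omega
        have h6 : ¬ (numWord d x j).toNat = (numWord d y j).toNat := by omega
        simp only [h5, h6, false_and, or_false]
        have ht := Det.copy s' rFlag rZero
        have he : s'.setReg rFlag 0 = s.setReg rFlag 0 := by rw [hs', Store.setReg_setReg]
        rw [h4, he] at ht
        rw [show flagWord d False = 0 from if_neg id]
        exact ht
      · rw [h1, h2] at h h'
        have h5 : ¬ (numWord d x j).toNat < (numWord d y j).toNat := by omega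
        have h6 : (numWord d x j).toNat = (numWord d y j).toNat := by omega
        simp only [h6, lt_irrefl, false_or, true_and]
        exact (Det.skip s').mono (by norm_num)
  simp only [mul_zero, pow_zero, Nat.mod_one, lt_irrefl, true_and, false_or,
    Nat.mod_eq_of_lt hxn, Nat.mod_eq_of_lt hyn] at this
  rw [← hb, Store.setReg_self] at this
  exact this

/-- Subtract one from the `n`-word number that starts at the `j`-th register of the group `g`.  The
flag tells whether it was positive before; if it was not, the number has no meaning afterwards. -/
def decrFrom (g : ℕ) : ℕ → ℕ → Cmd
  | 0, _ => .op (.copy rFlag rZero)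
  | n + 1, j => .ifEq (slot g j) rZero
      (.seq (.op (.bin .sub (slot g j) (slot g j) rOne)) (decrFrom g n (j + 1)))
      (.seq (.op (.bin .sub (slot g j) (slot g j) rOne)) (.op (.copy rFlag rOne)))

lemma Det.decrFrom {g : ℕ} (hg : 0 < g) (hg8 : g < 8) (n j : ℕ) {s : Store d} (hc : s.Consts)
    {y : ℕ} (hyn : y < 2 ^ (d * n)) (hy : ∀ i < n, s.reg (slot g (j + i)) = numWord d y i) :
    ∃ s', Det (decrFrom g n j) s (3 * n + 1) s' ∧ s'.mem = s.mem ∧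
      (∀ r, r ≠ rFlag → (∀ i < n, r ≠ slot g (j + i)) → s'.reg r = s.reg r) ∧
      (y = 0 → s'.reg rFlag = 0) ∧
      (y ≠ 0 → s'.reg rFlag = 1 ∧ ∀ i < n, s'.reg (slot g (j + i)) = numWord d (y - 1) i) := by
  induction n generalizing j s y with
  | zero =>
    refine ⟨_, Det.copy s rFlag rZero, rfl, fun r hr _ => ?_, fun _ => ?_, fun h => ?_⟩
    · simp [Store.setReg, hr]
    · simp [Store.setReg, hc.zero]
    · simp at hyn; omega
  | succ n ih =>
    set s₁ := s.setReg (slot g j) (numWord d y 0 - 1) with hs₁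
    have hd : 0 < 2 ^ d := by positivity
    have h0 := hy 0 (by omega)
    rw [add_zero] at h0
    have hsub : Det (.op (.bin .sub (slot g j) (slot g j) rOne)) s 1 s₁ := by
      have := Det.bin s .sub (slot g j) (slot g j) rOne
      rwa [h0, hc.one] at this
    have hc₁ : s₁.Consts := hc.congr fun j' _ => by
      rw [hs₁, Store.setReg_slot _ _ _ _ _ hg8 (by omega), if_neg (by omega)]
    by_cases hz : numWord d y 0 = 0
    · have hmod := numWord_zero_right_eq_zero_iff.1 hz
      have hy1 : ∀ i < n, s₁.reg (slot g (j + 1 + i)) = numWord d (y / 2 ^ d) i := by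
        intro i hi
        rw [hs₁, Store.setReg_slot _ _ _ _ _ hg8 hg8, if_neg (by omega), ← numWord_succ,
          ← hy (i + 1) (by omega)]
        congr 2; ring
      have hyn1 : y / 2 ^ d < 2 ^ (d * n) := by
        rw [Nat.div_lt_iff_lt_mul hd, ← pow_add]; convert hyn using 2; ring
      obtain ⟨s', h1, h2, h3, h4, h5⟩ := ih (j + 1) hc₁ hyn1 hy1
      have hdvd : y / 2 ^ d = 0 ↔ y = 0 := by
        rw [Nat.div_eq_zero_iff]
        constructor
        · rintro (h | h)
          · omega
          · rwa [Nat.mod_eq_of_lt h] at hmod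
        · rintro rfl; right; exact hd
      refine ⟨s', ?_, h2, fun r hr hr' => ?_, fun h => h4 (hdvd.2 h), fun h => ?_⟩
      · refine (Det.ifEq (t := 1 + (3 * n + 1)) (fun _ => hsub.seq h1) fun h => ?_).mono (by omega)
        exact absurd (by rw [h0, hc.zero, hz]) h
      · rw [h3 r hr fun i hi => ?_]
        · simp only [hs₁, Store.setReg]
          rw [if_neg (by simpa using hr' 0 (by omega))]
        · have := hr' (i + 1) (by omega)
          rwa [show j + 1 + i = j + (i + 1) by ring]
      · obtain ⟨h6, h7⟩ := h5 (mt hdvd.1 h)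
        refine ⟨h6, fun i hi => ?_⟩
        cases i with
        | zero =>
          rw [add_zero, h3 _ (by simp only [slot, ne_eq]; omega)
            (by intro i _; simp only [slot, ne_eq]; omega), hs₁,
            Store.setReg_slot _ _ _ _ _ hg8 hg8, if_pos ⟨rfl, rfl⟩, numWord_sub_one h]
        | succ i =>
          rw [show j + (i + 1) = j + 1 + i by ring, h7 i (by omega), numWord_succ,
            sub_one_div_of_dvd hd hmod]
    · have hmod := mt numWord_zero_right_eq_zero_iff.2 hz
      have hy0 : y ≠ 0 := by rintro rfl; simp at hmod
      refine ⟨s₁.setReg rFlag 1, ?_, rfl, fun r hr hr' => ?_, fun h => absurd h hy0,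
        fun _ => ⟨by simp [Store.setReg], fun i hi => ?_⟩⟩
      · refine (Det.ifEq (t := 2) (fun h => ?_) fun h => ?_).mono (by omega)
        · rw [h0, hc.zero] at h; exact absurd h hz
        · have := Det.copy s₁ rFlag rOne
          rw [hc₁.one] at this
          exact hsub.seq this
      · simp only [hs₁, Store.setReg]
        rw [if_neg hr, if_neg (by simpa using hr' 0 (by omega))]
      · rw [Store.setReg_slot _ _ _ _ _ (by omega) hg8, if_neg (by omega), hs₁,
          Store.setReg_slot _ _ _ _ _ hg8 hg8]
        cases i with
        | zero => rw [if_pos ⟨rfl, rfl⟩, numWord_sub_one hy0]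
        | succ i =>
          rw [if_neg (by omega), hy _ hi, numWord_succ, numWord_succ,
            sub_one_div_of_not_dvd hd hmod]

/-- Count the `c`-word number in the group `g` down to zero, and execute `body` after each
subtraction, with the new value of the counter. -/
def loopDown (g c : ℕ) (body : Cmd) : Cmd :=
  .seq (decrFrom g c 0) (.whileNe rFlag rZero (.seq body (decrFrom g c 0)))

/-- The cost of the loop `loopDown g c body` from the point before the counter is decreased. -/
noncomputable def loopCost (g c : ℕ) (body : Cmd) (f : Store d → ℝ≥0∞) : Store d → ℝ≥0∞ :=
  (decrFrom g c 0).wp fun s => 1 + (whileNe rFlag rZero (.seq body (decrFrom g c 0))).wp f s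

lemma wp_loopDown_le (g c : ℕ) (body : Cmd) (f : Store d → ℝ≥0∞) (s : Store d) :
    (loopDown g c body).wp f s ≤ loopCost g c body f s :=
  (wp_seq _ _ _ _).trans (wp_mono _ (fun _ => le_add_self) _)

lemma loopCost_zero_le {g c : ℕ} {s : Store d} (hg : 0 < g) (hg8 : g < 8) (hc : s.Consts)
    (h : s.Holds g c 0) :
    ∃ w, ∀ body f, loopCost g c body f s ≤
      (3 * c + 3 : ℕ) + f ((s.setArr g c w).setReg rFlag 0) := by
  obtain ⟨s', h1, h2, h3, h4, -⟩ := Det.decrFrom hg hg8 c 0 hc (y := 0) (by positivity)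
    (by simpa [Store.Holds] using h)
  refine ⟨fun j => s'.reg (slot g j), fun body f => ?_⟩
  have hs : (s.setArr g c fun j => s'.reg (slot g j)).setReg rFlag 0 = s' := by
    refine Store.ext (funext fun r => ?_) h2.symm
    by_cases hr : r = rFlag
    · simp [hr, Store.setReg, h4 rfl]
    · simp only [Store.setReg, Store.setArr, if_neg hr]
      split_ifs with hi
      · congr 1; simp only [slot]; omega
      · refine (h3 r hr ?_).symm
        rintro i hi' rfl
        simp only [slot] at hi; omega
  rw [hs]
  refine (h1 _).trans ?_
  have hw := wp_whileNe rFlag rZero (.seq body (decrFrom g c 0)) f s'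
  have hz : s'.reg rZero = 0 := by
    rw [h3 _ (by simp [slot]) (by intro i _; simp only [slot, ne_eq]; omega), hc.zero]
  rw [h4 rfl, hz, if_pos rfl] at hw
  calc _ ≤ ((3 * c + 1 : ℕ) : ℝ≥0∞) + (1 + (1 + f s')) := by gcongr
    _ = _ := by push_cast; ring

lemma loopCost_succ_le {g c : ℕ} {s : Store d} (hg : 0 < g) (hg8 : g < 8) (hc : s.Consts)
    (hd : 0 < d) {n : ℕ} (hn : n + 1 < 2 ^ (d * c)) (h : s.Holds g c (n + 1))
    (body : Cmd) (f : Store d → ℝ≥0∞) :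
    loopCost g c body f s ≤ (3 * c + 3 : ℕ) +
      body.wp (loopCost g c body f) ((s.setArr g c (numWord d n)).setReg rFlag 1) := by
  obtain ⟨s', h1, h2, h3, -, h5⟩ := Det.decrFrom hg hg8 c 0 hc hn (by simpa [Store.Holds] using h)
  obtain ⟨h5, h6⟩ := h5 (by omega)
  have hs : (s.setArr g c (numWord d n)).setReg rFlag 1 = s' := by
    refine Store.ext (funext fun r => ?_) h2.symm
    by_cases hr : r = rFlag
    · simp [hr, Store.setReg, h5]
    · simp only [Store.setReg, Store.setArr, if_neg hr]
      split_ifs with hi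
      · have := h6 (r / 16) hi.2
        rw [Nat.add_sub_cancel] at this
        rw [← this]; congr 1; simp only [slot]; omega
      · refine (h3 r hr ?_).symm
        rintro i hi' rfl
        simp only [slot] at hi; omega
  rw [hs]
  refine (h1 _).trans ?_
  have hw := wp_whileNe rFlag rZero (.seq body (decrFrom g c 0)) f s'
  have hz : s'.reg rZero = 0 := by
    rw [h3 _ (by simp [slot]) (by intro i _; simp only [slot, ne_eq]; omega), hc.zero]
  have h10 : ¬ (1 : BitVec d) = 0 := by
    rw [← BitVec.toNat_inj]
    simp only [BitVec.ofNat_eq_ofNat, BitVec.toNat_ofNat]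
    rw [Nat.mod_eq_of_lt (Nat.one_lt_two_pow (by omega))]; simp
  rw [h5, hz, if_neg h10] at hw
  calc _ ≤ ((3 * c + 1 : ℕ) : ℝ≥0∞) + (1 + (1 + body.wp (loopCost g c body f) s')) := by
        gcongr
        refine hw.trans ?_
        gcongr
        exact wp_seq _ _ _ _
    _ = _ := by push_cast; ring

/-- Invariant rule for a loop with a deterministic body. -/
lemma Det.loopDown {g c : ℕ} (hg : 0 < g) (hg8 : g < 8) (hd : 0 < d) (body : Cmd) (t : ℕ)
    (I : ℕ → Store d → Prop) {N : ℕ} (hN : N < 2 ^ (d * c))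
    (hI : ∀ n s, I n s → s.Holds g c n ∧ s.Consts)
    (hbody : ∀ n s, n < N → I (n + 1) s →
      ∃ s', Det body ((s.setArr g c (numWord d n)).setReg rFlag 1) t s' ∧ I n s')
    {s : Store d} (hs : I N s) :
    ∃ s₀ w, I 0 s₀ ∧
      Det (loopDown g c body) s ((N + 1) * (3 * c + 3 + t)) ((s₀.setArr g c w).setReg rFlag 0) := by
  suffices h : ∀ n ≤ N, ∀ s, I n s → ∃ s₀ w, I 0 s₀ ∧ ∀ f : Store d → ℝ≥0∞,
      loopCost g c body f s ≤
        ((n + 1) * (3 * c + 3 + t) : ℕ) + f ((s₀.setArr g c w).setReg rFlag 0) by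
    obtain ⟨s₀, w, h1, h2⟩ := h N le_rfl s hs
    exact ⟨s₀, w, h1, fun f => (wp_loopDown_le _ _ _ _ _).trans (h2 f)⟩
  intro n
  induction n with
  | zero =>
    intro _ s hs
    obtain ⟨w, hw⟩ := loopCost_zero_le hg hg8 (hI 0 s hs).2 (hI 0 s hs).1
    refine ⟨s, w, hs, fun f => (hw body f).trans ?_⟩
    gcongr; omega
  | succ n ih =>
    intro hn s hs
    obtain ⟨s', h1, h2⟩ := hbody n s hn hs
    obtain ⟨s₀, w, h3, h4⟩ := ih (by omega) s' h2
    refine ⟨s₀, w, h3, fun f => ?_⟩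
    refine (loopCost_succ_le hg hg8 (hI _ s hs).2 hd (by omega) (hI _ s hs).1 body f).trans ?_
    calc _ ≤ ((3 * c + 3 : ℕ) : ℝ≥0∞) + (t + (((n + 1) * (3 * c + 3 + t) : ℕ) +
          f ((s₀.setArr g c w).setReg rFlag 0))) := by
          gcongr
          exact (h1 _).trans (by gcongr; exact h4 f)
      _ = _ := by push_cast; ring

end Cmd

end WordRAM

/-! ### The sorting program -/

namespace WordRAM

variable {d : ℕ}

namespace Store

variable {s : Store d}

@[simp] lemma holds_setArr_of_ne {g g' n n' v : ℕ} {w : ℕ → BitVec d} (hg : g < 8) (hg' : g' < 8)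
    (h : g ≠ g') : (s.setArr g' n' w).Holds g n v ↔ s.Holds g n v :=
  forall₂_congr fun j _ => by rw [setArr_slot _ _ _ _ _ hg' hg, if_neg (by tauto)]

lemma holds_setArr {g n v : ℕ} {w : ℕ → BitVec d} (hg : g < 8) :
    (s.setArr g n w).Holds g n v ↔ ∀ j < n, w j = numWord d v j :=
  forall₂_congr fun j hj => by rw [setArr_slot _ _ _ _ _ hg hg, if_pos (by tauto)]

@[simp] lemma holds_setReg {g n v j : ℕ} {w : BitVec d} (hg : 0 < g) (hg8 : g < 8) :
    (s.setReg (slot 0 j) w).Holds g n v ↔ s.Holds g n v :=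
  forall₂_congr fun j _ => by
    rw [setReg_slot _ _ _ _ _ (by omega) hg8, if_neg (by omega)]

@[simp] lemma holds_withGuest {g n v : ℕ} {t : Store d} :
    (s.withGuest t).Holds g n v ↔ s.Holds g n v := by simp [Holds]

end Store

/-- Keys to be sorted, on a machine with `d`-bit words: `N` numbers of `k` words, where `N` fits
into `c` words. -/
structure Keys (c k d N : ℕ) where
  key : Fin N → ℕ
  pos : 0 < d
  card_lt : N < 2 ^ (d * c)
  key_lt : ∀ i, key i < 2 ^ (d * k)

namespace Keys

variable {c k N : ℕ} (X : Keys c k d N)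

/-- The exponent that stands for a key: the key, followed by the index, which makes exponents
distinct. -/
def expo (i : Fin N) : ℕ := i + 2 ^ (d * c) * X.key i

lemma index_lt (X : Keys c k d N) (i : Fin N) : (i : ℕ) < 2 ^ (d * c) := i.isLt.trans X.card_lt

lemma expo_injective : Function.Injective X.expo := fun i j h =>
  Fin.ext (eq_of_add_mul_eq (X.index_lt i) (X.index_lt j) h).1

lemma expo_lt (i : Fin N) : X.expo i < 2 ^ (d * (c + k)) := by
  have h1 := X.index_lt i
  have h2 : 2 ^ (d * c) * (X.key i + 1) ≤ 2 ^ (d * c) * 2 ^ (d * k) :=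
    Nat.mul_le_mul_left _ (X.key_lt i)
  rw [mul_add, pow_add]
  rw [mul_add, mul_one] at h2
  unfold expo; omega

/-- The permutation that puts the exponents into increasing order. -/
noncomputable def order : Equiv.Perm (Fin N) := Tuple.sort X.expo

lemma strictMono_order : StrictMono fun i => X.expo (X.order i) :=
  (Tuple.monotone_sort X.expo).strictMono_of_injective
    (X.expo_injective.comp X.order.injective)

/-- The constants are set, and the input is unchanged. -/
def Ready (s : Store d) : Prop :=
  s.Consts ∧ (∀ j < c, s.mem ⟨0, j, []⟩ = numWord d N j) ∧
    ∀ (i : Fin N), ∀ j < k, s.mem ⟨1, j, rowOf d c i⟩ = numWord d (X.key i) j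

/-- In addition, the output is complete from position `m` on. -/
def Progress (m : ℕ) (s : Store d) : Prop :=
  X.Ready s ∧ ∀ (i : Fin N), m ≤ i → ∀ j < k,
    s.mem ⟨2, j, rowOf d c i⟩ = numWord d (X.key (X.order i)) j

variable {X}

lemma Ready.congr {s s' : Store d} (h : X.Ready s)
    (hreg : ∀ j, j ≠ 2 → s'.reg (slot 0 j) = s.reg (slot 0 j))
    (hmem : ∀ a : Addr d, a.tbl < 2 → s'.mem a = s.mem a) : X.Ready s' :=
  ⟨h.1.congr hreg, fun j hj => (hmem _ (by simp)).trans (h.2.1 j hj),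
    fun i j hj => (hmem _ (by simp)).trans (h.2.2 i j hj)⟩

lemma Progress.congr {s s' : Store d} {m : ℕ} (h : X.Progress m s)
    (hreg : ∀ j, j ≠ 2 → s'.reg (slot 0 j) = s.reg (slot 0 j))
    (hmem : ∀ a : Addr d, a.tbl < 3 → s'.mem a = s.mem a) : X.Progress m s' :=
  ⟨h.1.congr hreg fun a ha => hmem a (by omega),
    fun i hi j hj => (hmem _ (by simp)).trans (h.2 i hi j hj)⟩

lemma Ready.progress {s : Store d} (h : X.Ready s) : X.Progress N s :=
  ⟨h, fun i hi => absurd i.isLt (by omega)⟩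

lemma Ready.setArr {s : Store d} (h : X.Ready s) {g : ℕ} (hg : 0 < g) (hg8 : g < 8) (n : ℕ)
    (w : ℕ → BitVec d) : X.Ready (s.setArr g n w) :=
  h.congr (fun j _ => by rw [Store.setArr_slot _ _ _ _ _ hg8 (by omega), if_neg (by omega)])
    fun _ _ => rfl

lemma Ready.setFlag {s : Store d} (h : X.Ready s) (w : BitVec d) : X.Ready (s.setReg rFlag w) :=
  h.congr (fun j hj => by
    rw [Store.setReg_slot _ _ _ _ _ (by omega) (by omega), if_neg (by omega)]) fun _ _ => rfl

lemma Ready.setRow {s : Store d} (h : X.Ready s) {tbl : ℕ} (ht : 2 ≤ tbl) (n : ℕ)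
    (row : List (BitVec d)) (w : ℕ → BitVec d) : X.Ready (s.setRow tbl n row w) :=
  h.congr (fun j _ => rfl) fun a ha => by rw [Store.setRow_mem, if_neg (by omega)]

lemma Progress.setArr {s : Store d} {m : ℕ} (h : X.Progress m s) {g : ℕ} (hg : 0 < g)
    (hg8 : g < 8) (n : ℕ) (w : ℕ → BitVec d) : X.Progress m (s.setArr g n w) :=
  h.congr (fun j _ => by rw [Store.setArr_slot _ _ _ _ _ hg8 (by omega), if_neg (by omega)])
    fun _ _ => rfl

lemma Progress.setFlag {s : Store d} {m : ℕ} (h : X.Progress m s) (w : BitVec d) :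
    X.Progress m (s.setReg rFlag w) :=
  h.congr (fun j hj => by
    rw [Store.setReg_slot _ _ _ _ _ (by omega) (by omega), if_neg (by omega)]) fun _ _ => rfl

lemma Progress.setRow {s : Store d} {m : ℕ} (h : X.Progress m s) {tbl : ℕ} (ht : 3 ≤ tbl) (n : ℕ)
    (row : List (BitVec d)) (w : ℕ → BitVec d) : X.Progress m (s.setRow tbl n row w) :=
  h.congr (fun j _ => rfl) fun a ha => by rw [Store.setRow_mem, if_neg (by omega)]

lemma Progress.withGuest {s : Store d} {m : ℕ} (h : X.Progress m s) (v : Store d) :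
    X.Progress m (s.withGuest v) :=
  h.congr (fun j _ => by simp) fun a ha => Store.withGuest_mem_of_lt _ _ ha

lemma Progress.isSortedOutput {s : Store d} (h : X.Progress 0 s) : IsSortedOutput c k X.key s := by
  have hread : (fun i : Fin N => s.readNum 2 k (rowOf d c i)) = X.key ∘ X.order := by
    funext i
    exact (readNum_eq_iff (X.key_lt _)).2 (h.2 i (Nat.zero_le _))
  constructor
  · rw [hread]; exact Equiv.Perm.ofFn_comp_perm _ _
  · rw [hread, List.pairwise_ofFn]
    intro i j hij
    have := X.strictMono_order hij
    simp only [expo] at this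
    rw [add_mul_lt_add_mul_iff (X.index_lt _) (X.index_lt _)] at this
    simp only [Function.comp]; omega

end Keys

open Cmd

/-- Set the registers with constants; all registers are zero before. -/
def setConsts : Cmd :=
  .seq (.op (.const rOne 1)) (.seq (.op (.un .not rOnes rZero))
    (.op (.bin .shr rHalf rOnes rOne)))

/-- Write the exponent and the mantissa of one item.  The words of the exponent are those of the index,
which is the main counter, and those of the key, so no arithmetic is needed. -/
def writeItem (c k : ℕ) : Cmd :=
  .seq (loadArr 4 k 1 (slots 1 c)) (.seq
    (storeRow (1 + 3) (c + k) (slots 1 c) fun j => if j < c then slot 1 j else slot 4 (j - c))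
    (storeRow (2 + 3) 1 (slots 1 c) fun _ => rOne))

/-- Write the input of the data structure, and set the main counter, group `1`, to `N`. -/
def writeItems (c k : ℕ) : Cmd :=
  .seq setConsts (.seq (loadArr 1 c 0 []) (.seq (storeRow (0 + 3) c [] (slot 1))
    (.seq (loopDown 1 c (writeItem c k)) (loadArr 1 c 0 []))))

/-- Write a query parameter that has only one non-zero word, given in the register `r`. -/
def writeParam (tbl pw r : ℕ) : Cmd := storeRow tbl pw [] fun j => if j = 0 then r else rZero

/-- Write the parameters of all queries: `α` is slightly less than `1 / 2`, and `β` is the inverse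
of the greatest word. -/
def writeParams (pw : ℕ) : Cmd :=
  .seq (writeParam (4 + 3) pw rHalf) (.seq (writeParam (5 + 3) pw rOnes)
    (.seq (writeParam (6 + 3) pw rOne) (writeParam (7 + 3) pw rOnes)))

/-- Compare the item at the position in the counter, group `2`, of the query result with the best one
so far.  Index and key of an item are in the groups `3` and `4`, those of the best one in the groups
`5` and `6`.  Comparing the indices before the keys compares the exponents. -/
def scanItem (c k : ℕ) : Cmd :=
  .seq (loadArr 3 c (9 + 3) (slots 2 c)) (.seq (loadArr 4 k 1 (slots 3 c))
    (.seq (.op (.copy rFlag rZero)) (.seq (Cmd.compare 5 3 c) (.seq (Cmd.compare 6 4 k)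
      (.ifEq rFlag rZero .skip (.seq (copyArr 5 3 c) (copyArr 6 4 k)))))))

/-- Find the item of the query result with the largest exponent. -/
def selectMax (c k : ℕ) : Cmd :=
  .seq (forN (fun j => .op (.copy (slot 5 j) rZero)) c)
    (.seq (forN (fun j => .op (.copy (slot 6 j) rZero)) k)
      (.seq (loadArr 2 c (8 + 3) []) (loopDown 2 c (scanItem c k))))

/-- Put out the key of the item that was found, and pass its name to the deletion. -/
def writeOutput (c k : ℕ) : Cmd :=
  .seq (storeRow 2 k (slots 1 c) (slot 6)) (storeRow (3 + 3) c [] (slot 5))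

/-- Remove the item with the largest exponent from the data structure. -/
def extractMax (c k pw : ℕ) (A : DPSS.Algorithm) : Cmd :=
  .seq (writeParams pw) (.seq (.call A.query) (.seq (selectMax c k) (.seq (writeOutput c k)
    (.call A.delete))))

/-- The sorting program.  The main counter counts down, so the output is written from its end. -/
def sorter (c k pw : ℕ) (A : DPSS.Algorithm) : Cmd :=
  .seq (writeItems c k) (.seq (.call A.init) (loopDown 1 c (extractMax c k pw A)))

namespace Cmd

lemma Det.fill (s : Store d) {g : ℕ} (hg : 0 < g) (hg8 : g < 8) (n : ℕ) (h0 : s.reg rZero = 0) :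
    Det (Cmd.forN (fun j => Cmd.op (.copy (slot g j) rZero)) n) s n (s.setArr g n fun _ => 0) := by
  have := Det.forN (c := fun j => Cmd.op (.copy (slot g j) rZero)) (n := n) (t := 1)
    (fun m => s.setArr g m fun _ => 0) fun j _ => by
      rw [← Store.setArr_succ _ _ _ hg8]
      refine Det.op fun i => ?_
      simp only [Instr.exec]
      rw [Store.setArr_slot _ _ _ _ _ hg8 (by omega), if_neg (by omega), h0]
  rw [mul_one, Store.setArr_zero] at this
  exact this

end Cmd

section Scan

variable {c k N : ℕ} {X : Keys c k d N}

/-- The invariant of the scan through a query result `l`, of which the positions from `n` on have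
been visited: the groups `5` and `6` hold index and key of the best item, or zeros. -/
def ScanInv (X : Keys c k d N) (m : ℕ) (v : Store d) (l : List (Fin N)) (n : ℕ) (s : Store d) :
    Prop :=
  X.Progress (m + 1) s ∧ s.Holds 1 c m ∧ s.guest = v ∧ s.Holds 2 c n ∧ n ≤ l.length ∧
    ∃ x y, x < 2 ^ (d * c) ∧ y < 2 ^ (d * k) ∧ s.Holds 5 c x ∧ s.Holds 6 k y ∧
      (∀ (i : ℕ) (hi : i < l.length), n ≤ i → X.expo l[i] ≤ x + 2 ^ (d * c) * y) ∧
      (x + 2 ^ (d * c) * y = 0 ∨ ∃ z ∈ l, x + 2 ^ (d * c) * y = X.expo z)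

lemma det_scanItem {m n : ℕ} {v s : Store d} {l : List (Fin N)}
    (hv : ∀ (i : ℕ) (hi : i < l.length), v.readNum 9 c (rowOf d c i) = (l[i] : ℕ))
    (hn : n < l.length) (h : ScanInv X m v l (n + 1) s) :
    ∃ s', Det (scanItem c k) ((s.setArr 2 c (numWord d n)).setReg rFlag 1)
      (7 * c + 7 * k + 3) s' ∧ ScanInv X m v l n s' := by
  obtain ⟨hP, h1, hg, h2, -, x, y, hx, hy, h5, h6, hmax, hmem⟩ := h
  set z := l[n] with hz
  set s₁ := (s.setArr 2 c (numWord d n)).setReg rFlag 1 with hs₁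
  have p1 : X.Progress (m + 1) s₁ := (hP.setArr (by norm_num) (by norm_num) _ _).setFlag _
  have g1 : s₁.guest = v := by rw [hs₁]; simpa using hg
  have c1 : s₁.Holds 2 c n := by
    rw [hs₁, Store.holds_setReg (by norm_num) (by norm_num), Store.holds_setArr (by norm_num)]
    exact fun _ _ => rfl
  set s₂ := s₁.setArr 3 c fun j => s₁.mem ⟨9 + 3, j, (slots 2 c).map s₁.reg⟩ with hs₂
  have d2 : Det (loadArr 3 c (9 + 3) (slots 2 c)) s₁ c s₂ := Det.loadArr (by norm_num) _ _
    fun j w => Store.map_slots_setArr _ _ _ (by norm_num) (by norm_num) (by norm_num) _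
  have i2 : s₂.Holds 3 c z := by
    rw [hs₂, Store.holds_setArr (by norm_num), c1.map_slots]
    have := (readNum_eq_iff (X.index_lt z)).1 (hv n hn)
    rw [← g1] at this
    exact this
  set s₃ := s₂.setArr 4 k fun j => s₂.mem ⟨1, j, (slots 3 c).map s₂.reg⟩ with hs₃
  have d3 : Det (loadArr 4 k 1 (slots 3 c)) s₂ k s₃ := Det.loadArr (by norm_num) _ _
    fun j w => Store.map_slots_setArr _ _ _ (by norm_num) (by norm_num) (by norm_num) _
  have k3 : s₃.Holds 4 k (X.key z) := by
    rw [hs₃, Store.holds_setArr (by norm_num), i2.map_slots]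
    exact p1.1.2.2 z
  have p3 : X.Progress (m + 1) s₃ :=
    (p1.setArr (by norm_num) (by norm_num) _ _).setArr (by norm_num) (by norm_num) _ _
  set s₄ := s₃.setReg rFlag (flagWord d False) with hs₄
  have d4 : Det (.op (.copy rFlag rZero)) s₃ 1 s₄ := by
    have := Det.copy s₃ rFlag rZero
    rwa [p3.1.1.zero, show (0 : BitVec d) = flagWord d False from (if_neg id).symm] at this
  have p4 : X.Progress (m + 1) s₄ := p3.setFlag _
  have f4 : s₄.reg rFlag = flagWord d False := by simp [hs₄, Store.setReg]
  have x4 : s₄.Holds 5 c x := by simpa [hs₄, hs₃, hs₂, hs₁] using h5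
  have y4 : s₄.Holds 6 k y := by simpa [hs₄, hs₃, hs₂, hs₁] using h6
  have i4 : s₄.Holds 3 c z := by simpa [hs₄, hs₃] using i2
  have k4 : s₄.Holds 4 k (X.key z) := by simpa [hs₄] using k3
  have d5 := Det.compare (by norm_num) (by norm_num) (by norm_num) (by norm_num) p4.1.1 x4 i4 hx
    (X.index_lt z) f4
  set s₅ := s₄.setReg rFlag (flagWord d (x < z ∨ (x = z ∧ False))) with hs₅
  have p5 : X.Progress (m + 1) s₅ := p4.setFlag _
  have f5 : s₅.reg rFlag = flagWord d (x < z ∨ (x = z ∧ False)) := by simp [hs₅, Store.setReg]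
  have y5 : s₅.Holds 6 k y := by simpa [hs₅] using y4
  have k5 : s₅.Holds 4 k (X.key z) := by simpa [hs₅] using k4
  have d6 := Det.compare (by norm_num) (by norm_num) (by norm_num) (by norm_num) p5.1.1 y5 k5 hy
    (X.key_lt z) f5
  have hb : (y < X.key z ∨ (y = X.key z ∧ (x < z ∨ (x = z ∧ False)))) ↔
      x + 2 ^ (d * c) * y < X.expo z := by
    rw [Keys.expo, add_mul_lt_add_mul_iff hx (X.index_lt z)]; simp
  rw [hb] at d6
  set s₆ := s₅.setReg rFlag (flagWord d (x + 2 ^ (d * c) * y < X.expo z)) with hs₆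
  have p6 : X.Progress (m + 1) s₆ := p5.setFlag _
  have f6 : s₆.reg rFlag = flagWord d (x + 2 ^ (d * c) * y < X.expo z) := by
    simp [hs₆, Store.setReg]
  have d06 := d2.seq (d3.seq (d4.seq (d5.seq (d6.seq (Det.skip s₆)))))
  have g6 : s₆.guest = v := by simpa [hs₆, hs₅, hs₄, hs₃, hs₂] using g1
  have m6 : s₆.Holds 1 c m := by simpa [hs₆, hs₅, hs₄, hs₃, hs₂, hs₁] using h1
  have n6 : s₆.Holds 2 c n := by simpa [hs₆, hs₅, hs₄, hs₃, hs₂] using c1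
  have x6 : s₆.Holds 5 c x := by simpa [hs₆, hs₅] using x4
  have y6 : s₆.Holds 6 k y := by simpa [hs₆] using y5
  by_cases hlt : x + 2 ^ (d * c) * y < X.expo z
  · set s₇ := s₆.setArr 5 c (fun j => s₆.reg (slot 3 j)) with hs₇
    set s₈ := s₇.setArr 6 k (fun j => s₇.reg (slot 4 j)) with hs₈
    have d8 : Det (.ifEq rFlag rZero .skip (.seq (copyArr 5 3 c) (copyArr 6 4 k))) s₆
        ((c + k) + 2) s₈ := by
      refine Det.ifEq (fun h => ?_) fun _ =>
        (Det.copyArr s₆ (by norm_num) (by norm_num) (by norm_num) c).seq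
          (Det.copyArr s₇ (by norm_num) (by norm_num) (by norm_num) k)
      rw [f6, p6.1.1.zero, flagWord, if_pos hlt, ← BitVec.toNat_inj] at h
      simp only [BitVec.ofNat_eq_ofNat, BitVec.toNat_ofNat] at h
      rw [Nat.mod_eq_of_lt (Nat.one_lt_two_pow (by have := X.pos; omega))] at h
      simp at h
    refine ⟨s₈, (d2.seq (d3.seq (d4.seq (d5.seq (d6.seq d8))))).mono (by omega), ?_, ?_, ?_, ?_,
      by omega, z, X.key z, X.index_lt z, X.key_lt z, ?_, ?_, fun i hi hni => ?_,
      Or.inr ⟨z, List.getElem_mem _, rfl⟩⟩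
    · exact (p6.setArr (by norm_num) (by norm_num) _ _).setArr (by norm_num) (by norm_num) _ _
    · simpa [hs₈, hs₇] using m6
    · simpa [hs₈, hs₇] using g6
    · simpa [hs₈, hs₇] using n6
    · rw [hs₈, Store.holds_setArr_of_ne (by norm_num) (by norm_num) (by norm_num), hs₇,
        Store.holds_setArr (by norm_num)]
      have : s₆.Holds 3 c z := by simpa [hs₆, hs₅] using i4
      exact this
    · rw [hs₈, Store.holds_setArr (by norm_num)]
      have : s₇.Holds 4 k (X.key z) := by simpa [hs₇, hs₆] using k5
      exact this
    · rcases hni.eq_or_lt with rfl | hlt'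
      · exact le_rfl
      · exact (hmax i hi hlt').trans hlt.le
  · have d8 : Det (.ifEq rFlag rZero .skip (.seq (copyArr 5 3 c) (copyArr 6 4 k))) s₆
        (0 + 2) s₆ := by
      refine Det.ifEq (fun _ => Det.skip _) fun h => ?_
      rw [f6, p6.1.1.zero, flagWord, if_neg hlt] at h
      exact absurd rfl h
    refine ⟨s₆, (d2.seq (d3.seq (d4.seq (d5.seq (d6.seq d8))))).mono (by omega), p6, m6, g6, n6,
      by omega, x, y, hx, hy, x6, y6, fun i hi hni => ?_, hmem⟩
    rcases hni.eq_or_lt with rfl | hlt'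
    · exact not_lt.1 hlt
    · exact hmax i hi hlt'

lemma det_selectMax {m : Fin N} {v s : Store d} {l : List (Fin N)}
    (hsize : v.readNum 8 c [] = l.length)
    (hv : ∀ (i : ℕ) (hi : i < l.length), v.readNum 9 c (rowOf d c i) = (l[i] : ℕ))
    (hm : X.order m ∈ l) (hmax : ∀ x ∈ l, X.expo x ≤ X.expo (X.order m))
    (hP : X.Progress (m + 1) s) (h1 : s.Holds 1 c m) (hg : s.guest = v) :
    ∃ s', Det (selectMax c k) s ((l.length + 1) * (20 * (c + k) + 20)) s' ∧
      X.Progress (m + 1) s' ∧ s'.Holds 1 c m ∧ s'.guest = v ∧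
      s'.Holds 5 c (X.order m) ∧ s'.Holds 6 k (X.key (X.order m)) := by
  have hl : l.length < 2 ^ (d * c) := hsize ▸ readNum_lt v 8 c []
  set s₁ := s.setArr 5 c fun _ => 0 with hs₁
  have d1 := Det.fill s (g := 5) (by norm_num) (by norm_num) c hP.1.1.zero
  have p1 : X.Progress (m + 1) s₁ := hP.setArr (by norm_num) (by norm_num) _ _
  set s₂ := s₁.setArr 6 k fun _ => 0 with hs₂
  have d2 := Det.fill s₁ (g := 6) (by norm_num) (by norm_num) k p1.1.1.zero
  have p2 : X.Progress (m + 1) s₂ := p1.setArr (by norm_num) (by norm_num) _ _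
  have d3 : Det (loadArr 2 c (8 + 3) []) s₂ c _ :=
    Det.loadArr (by norm_num) _ _ fun _ _ => rfl
  set s₃ := s₂.setArr 2 c fun j => s₂.mem ⟨8 + 3, j, [].map s₂.reg⟩ with hs₃
  have hI : ScanInv X m v l l.length s₃ := by
    refine ⟨p2.setArr (by norm_num) (by norm_num) _ _, ?_, ?_, ?_, le_rfl, 0, 0, by positivity,
      by positivity, ?_, ?_, fun i hi hi' => absurd hi (by omega), Or.inl (by simp)⟩
    · simpa [hs₃, hs₂, hs₁] using h1
    · simpa [hs₃, hs₂, hs₁] using hg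
    · rw [hs₃, Store.holds_setArr (by norm_num)]
      have := (readNum_eq_iff hl).1 hsize
      rw [← hg] at this
      exact this
    · rw [hs₃, Store.holds_setArr_of_ne (by norm_num) (by norm_num) (by norm_num), hs₂,
        Store.holds_setArr_of_ne (by norm_num) (by norm_num) (by norm_num), hs₁,
        Store.holds_setArr (by norm_num)]
      exact fun j _ => (numWord_zero_left d j).symm
    · rw [hs₃, Store.holds_setArr_of_ne (by norm_num) (by norm_num) (by norm_num), hs₂,
        Store.holds_setArr (by norm_num)]
      exact fun j _ => (numWord_zero_left d j).symm
  obtain ⟨s₀, w, ⟨p0, m0, g0, -, -, x, y, hx, hy, x0, y0, hge, hmem⟩, d4⟩ :=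
    Det.loopDown (g := 2) (by norm_num) (by norm_num) X.pos (scanItem c k) _ (ScanInv X m v l) hl
      (fun n s h => ⟨h.2.2.2.1, h.1.1.1⟩) (fun n s hn h => det_scanItem hv hn h) hI
  -- the initial value `0` of the best exponent is attained only if the largest exponent is `0`
  have hxy : x + 2 ^ (d * c) * y = X.expo (X.order m) := by
    obtain ⟨i, hi, hi'⟩ := List.getElem_of_mem hm
    have h1 := hge i hi (Nat.zero_le _)
    rw [hi'] at h1
    refine le_antisymm ?_ h1
    rcases hmem with h | ⟨z, hz, h⟩
    · omega
    · rw [h]; exact hmax z hz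
  obtain ⟨rfl, rfl⟩ := eq_of_add_mul_eq hx (X.index_lt _) hxy
  refine ⟨_, (d1.seq (d2.seq (d3.seq d4))).mono ?_,
    (p0.setArr (g := 2) (by norm_num) (by norm_num) _ _).setFlag _, ?_, ?_, ?_, ?_⟩
  · have h1 : (l.length + 1) * (3 * c + 3 + (7 * c + 7 * k + 3)) + (l.length + 1) * (2 * c + k) ≤
        (l.length + 1) * (20 * (c + k) + 20) := by
      rw [← mul_add]; exact Nat.mul_le_mul_left _ (by omega)
    have h2 : 2 * c + k ≤ (l.length + 1) * (2 * c + k) := Nat.le_mul_of_pos_left _ (by omega)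
    omega
  · simpa using m0
  · simpa using g0
  · simpa using x0
  · simpa using y0

end Scan

end WordRAM

/-! ### Final stores -/

namespace WordRAM

variable {d : ℕ}

lemma runFor_halted_mono (P : Program) (x : Config d) (s' : Store d) :
    Monotone fun n => runFor P n x ⟨none, s'⟩ := by
  refine monotone_nat_of_le_succ fun n => ?_
  induction n generalizing x with
  | zero =>
    by_cases h : x = ⟨none, s'⟩
    · subst h; simp [runFor_none]
    · simp [runFor, PMF.pure_apply, Ne.symm h]
  | succ n ih =>
    change ((step P x).bind (runFor P n)) _ ≤ ((step P x).bind (runFor P (n + 1))) _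
    simp only [PMF.bind_apply]
    exact ENNReal.tsum_le_tsum fun y => by gcongr; exact ih y

lemma tsum_finalMass_le_one (P : Program) (s : Store d) : ∑' s', finalMass P s s' ≤ 1 := by
  rw [ENNReal.tsum_eq_iSup_sum]
  refine iSup_le fun S => ?_
  unfold finalMass
  rw [ENNReal.finsetSum_iSup_of_monotone fun s' => runFor_halted_mono P (start s) s']
  refine iSup_le fun n => ?_
  have hinj : Function.Injective (fun s : Store d => (⟨none, s⟩ : Config d)) := by
    intro s t h; simpa using h
  calc ∑ s' ∈ S, runFor P n (start s) ⟨none, s'⟩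
      ≤ ∑' s', runFor P n (start s) ⟨none, s'⟩ := ENNReal.sum_le_tsum _
    _ ≤ ∑' y, runFor P n (start s) y := ENNReal.tsum_comp_le_tsum_of_injective hinj _
    _ = 1 := PMF.tsum_coe _

lemma HaltsWithin.mono {P : Program} {s : Store d} {n k : ℕ} (h : HaltsWithin P s n)
    (hk : n ≤ k) : HaltsWithin P s k := by
  have key : ∀ m (x : Config d), (∀ y ∈ (runFor P m x).support, y.pc = none) →
      ∀ y ∈ (runFor P (m + 1) x).support, y.pc = none := by
    intro m
    induction m with
    | zero =>
      intro x hx y hy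
      obtain ⟨pc, s⟩ := x
      have : pc = none := hx ⟨pc, s⟩ (by simp [runFor])
      subst this
      rw [runFor_none] at hy
      simp at hy; rw [hy]
    | succ m ih =>
      intro x hx y hy
      rw [runFor, PMF.mem_support_bind_iff] at hy
      obtain ⟨z, hz, hy⟩ := hy
      refine ih z (fun y' hy' => hx y' ?_) y hy
      rw [runFor, PMF.mem_support_bind_iff]
      exact ⟨z, hz, hy'⟩
  induction k, hk using Nat.le_induction with
  | base => exact h
  | succ k _ ih => exact key k _ ih

lemma HaltsWithin.expectedTime_le {P : Program} {s : Store d} {n : ℕ} (h : HaltsWithin P s n) :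
    expectedTime P s ≤ n := by
  unfold expectedTime
  rw [tsum_eq_sum (s := Finset.range n)]
  · refine (Finset.sum_le_card_nsmul _ _ 1 fun k _ => ?_).trans (by simp)
    rw [toOuterMeasure_eq_expect]
    refine (expect_mono _ (G := fun _ => 1) fun y => ?_).trans ?_
    · exact Set.indicator_le_self' (fun _ _ => zero_le) _
    · simp [expect, PMF.tsum_coe]
  · intro k hk
    rw [PMF.toOuterMeasure_apply_eq_zero_iff, Set.disjoint_left]
    intro y hy hy'
    exact hy' (h.mono (by simpa using hk) y hy)

lemma HaltsWithin.one_le {P : Program} {s : Store d} {n : ℕ} (h : HaltsWithin P s n) : 1 ≤ n := by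
  by_contra! hn
  obtain rfl : n = 0 := by omega
  have := h (start s) (by simp [runFor])
  simp [start] at this

lemma HaltsWithin.exists_finalMass_ne_zero {P : Program} {s : Store d} {n : ℕ}
    (h : HaltsWithin P s n) : ∃ s', finalMass P s s' ≠ 0 := by
  obtain ⟨⟨pc, s'⟩, hy⟩ := (runFor P n (start s)).support_nonempty
  obtain rfl : pc = none := h _ hy
  refine ⟨s', fun h0 => (PMF.mem_support_iff _ _).1 hy ?_⟩
  exact le_antisymm ((le_iSup (fun n => runFor P n (start s) ⟨none, s'⟩) n).trans h0.le) (zero_le)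

end WordRAM

namespace DPSS

open WordRAM

variable {F : Format} {d N : ℕ}

/-! ### Sampling probabilities -/

/-- The distribution of a random subset with independent elements: total mass and expected size. -/
lemma sum_powerset_prod_mul_card {ι : Type*} [DecidableEq ι] (S : Finset ι) (q : ι → ℝ≥0)
    (hq : ∀ x, q x ≤ 1) :
    ∑ T ∈ S.powerset, ((∏ x ∈ T, q x) * ∏ x ∈ S \ T, (1 - q x)) = 1 ∧
    ∑ T ∈ S.powerset, ((∏ x ∈ T, q x) * ∏ x ∈ S \ T, (1 - q x)) * (T.card : ℝ≥0) =
      ∑ x ∈ S, q x := by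
  have hone : ∀ S : Finset ι,
      ∑ T ∈ S.powerset, ((∏ x ∈ T, q x) * ∏ x ∈ S \ T, (1 - q x)) = 1 := fun S => by
    rw [← Finset.prod_add]
    exact Finset.prod_eq_one fun x _ => add_tsub_cancel_of_le (hq x)
  refine ⟨hone S, ?_⟩
  induction S using Finset.induction_on with
  | empty => simp
  | insert a S ha ih =>
    rw [Finset.sum_powerset_insert ha, Finset.sum_insert ha]
    have h1 : ∀ T ∈ S.powerset, ((∏ x ∈ T, q x) * ∏ x ∈ insert a S \ T, (1 - q x)) * (T.card : ℝ≥0) =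
        (1 - q a) * (((∏ x ∈ T, q x) * ∏ x ∈ S \ T, (1 - q x)) * (T.card : ℝ≥0)) := by
      intro T hT
      have haT : a ∉ T := fun h => ha (Finset.mem_powerset.1 hT h)
      rw [Finset.insert_sdiff_of_notMem _ haT, Finset.prod_insert (by simp [ha])]
      ring
    have h2 : ∀ T ∈ S.powerset, ((∏ x ∈ insert a T, q x) *
        ∏ x ∈ insert a S \ insert a T, (1 - q x)) * ((insert a T).card : ℝ≥0) =
        q a * (((∏ x ∈ T, q x) * ∏ x ∈ S \ T, (1 - q x)) * (T.card : ℝ≥0)) +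
          q a * ((∏ x ∈ T, q x) * ∏ x ∈ S \ T, (1 - q x)) := by
      intro T hT
      have haT : a ∉ T := fun h => ha (Finset.mem_powerset.1 hT h)
      have : insert a S \ insert a T = S \ T := by
        ext x; simp only [Finset.mem_sdiff, Finset.mem_insert]
        constructor
        · rintro ⟨h1 | h1, h2⟩ <;> tauto
        · rintro ⟨h1, h2⟩
          refine ⟨Or.inr h1, ?_⟩
          rintro (h | h)
          · exact ha (h ▸ h1)
          · exact h2 h
      rw [this, Finset.prod_insert haT, Finset.card_insert_of_notMem haT]
      push_cast; ring
    rw [Finset.sum_congr rfl h1, Finset.sum_congr rfl h2, Finset.sum_add_distrib,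
      ← Finset.mul_sum, ← Finset.mul_sum, ← Finset.mul_sum, hone S, ih]
    calc (1 - q a) * ∑ x ∈ S, q x + (q a * ∑ x ∈ S, q x + q a * 1)
        = ((1 - q a) + q a) * ∑ x ∈ S, q x + q a := by ring
      _ = q a + ∑ x ∈ S, q x := by rw [tsub_add_cancel_of_le (hq a)]; ring

variable (I : Items F d N) (S : Finset (Fin N)) (p : Params F d)

lemma Items.sum_sampleProb : ∑ T, I.sampleProb S p T = 1 := by
  simp only [Items.sampleProb, Finset.sum_ite, Finset.sum_const_zero, add_zero]
  refine Eq.trans ?_ (sum_powerset_prod_mul_card S (I.prob S p) fun x => min_le_right _ _).1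
  refine Finset.sum_congr ?_ fun _ _ => rfl
  ext; simp

lemma Items.sum_sampleProb_mul_card : ∑ T, I.sampleProb S p T * (T.card : ℝ≥0) = I.mu S p := by
  simp only [Items.sampleProb, ite_mul, zero_mul, Finset.sum_ite, Finset.sum_const_zero, add_zero]
  rw [Items.mu, ← (sum_powerset_prod_mul_card S (I.prob S p) fun x => min_le_right _ _).2]
  refine Finset.sum_congr ?_ fun _ _ => rfl
  ext; simp

variable {I S p}

lemma Items.subset_of_sampleProb_ne_zero {T : Finset (Fin N)} (h : I.sampleProb S p T ≠ 0) :
    T ⊆ S := by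
  by_contra hT
  exact h (if_neg hT)

lemma Items.mem_of_prob_eq_one {T : Finset (Fin N)} (h : I.sampleProb S p T ≠ 0) {x : Fin N}
    (hx : x ∈ S) (hp : I.prob S p x = 1) : x ∈ T := by
  by_contra hT
  refine h ?_
  rw [sampleProb, if_pos (subset_of_sampleProb_ne_zero h)]
  refine mul_eq_zero_of_right _ (Finset.prod_eq_zero (Finset.mem_sdiff.2 ⟨hx, hT⟩) ?_)
  simp [hp]

/-! ### Histories -/

lemma Returns.unique {s : Store d} {T T' : Finset (Fin N)} (h : Returns F s T)
    (h' : Returns F s T') : T = T' := by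
  obtain ⟨l, -, rfl, h1, h2⟩ := h
  obtain ⟨l', -, rfl, h1', h2'⟩ := h'
  congr 1
  have hl : l.length = l'.length := h1.symm.trans h1'
  refine List.ext_getElem hl fun i hi hi' => Fin.ext ?_
  rw [← h2 i hi, ← h2' i hi']

variable (A : Algorithm)

lemma tsum_mul_finalMass_le (μ : Store d → ℝ≥0∞) (P : Program) (f : Store d → Store d) :
    ∑' s', ∑' s, μ s * finalMass P (f s) s' ≤ ∑' s, μ s := by
  rw [ENNReal.tsum_comm]
  refine ENNReal.tsum_le_tsum fun s => ?_
  rw [ENNReal.tsum_mul_left]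
  calc μ s * ∑' s', finalMass P (f s) s' ≤ μ s * 1 := by gcongr; exact tsum_finalMass_le_one _ _
    _ = μ s := mul_one _

lemma Algorithm.histProb_delete_le (h : History F d N) (x : Fin N) :
    A.histProb I (.delete x :: h) ≤ A.histProb I h :=
  tsum_mul_finalMass_le _ _ _

lemma Algorithm.histProb_le_one (h : History F d N) : A.histProb I h ≤ 1 := by
  induction h with
  | nil => exact tsum_finalMass_le_one _ _
  | cons e h ih =>
    cases e with
    | query p T =>
      refine le_trans ?_ ((tsum_mul_finalMass_le (A.mass I h) A.query (setParams p)).trans ih)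
      refine ENNReal.tsum_le_tsum fun s => ?_
      simp only [Algorithm.mass]
      split_ifs
      · exact le_rfl
      · exact zero_le
    | delete x => exact (A.histProb_delete_le h x).trans ih

variable {A} {D : Set (ℕ × ℕ)} {tp tq td : ℕ → ℝ≥0}

/-- A query almost surely returns some set, because the probabilities of the possible results add up
to one and a final store determines the result; so a sum over its final stores splits into sums over
the possible results. -/
lemma Algorithm.Solves.tsum_query (hA : A.Solves F D tp tq td) (hD : (N, d) ∈ D)
    {h : History F d N} (hl : Legal I h) (hp : 0 < I.totalWeight (live h) p)
    (H : Store d → ℝ≥0∞) :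
    ∑' s, A.mass I h s * ∑' s', finalMass A.query (setParams p s) s' * H s' =
      ∑ T, ∑' s', A.mass I (.query p T :: h) s' * H s' := by
  set q : Store d → ℝ≥0∞ := fun s' => ∑' s, A.mass I h s * finalMass A.query (setParams p s) s'
  have hle : ∀ s', ∑ T, A.mass I (.query p T :: h) s' ≤ q s' := by
    intro s'
    by_cases hR : ∃ T : Finset (Fin N), Returns F s' T
    · obtain ⟨T, hT⟩ := hR
      rw [Finset.sum_eq_single T]
      · simp only [Algorithm.mass]; rw [if_pos hT]
      · intro T' _ hT'
        simp only [Algorithm.mass]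
        exact if_neg fun h => hT' (h.unique hT)
      · simp
    · rw [Finset.sum_eq_zero]
      · exact zero_le
      · intro T _
        simp only [Algorithm.mass]
        exact if_neg fun h => hR ⟨T, h⟩
  have hsum : ∑' s', ∑ T, A.mass I (.query p T :: h) s' = A.histProb I h := by
    rw [Summable.tsum_finsetSum fun _ _ => ENNReal.summable]
    calc ∑ T, ∑' s', A.mass I (.query p T :: h) s'
        = ∑ T, A.histProb I h * (I.sampleProb (live h) p T : ℝ≥0∞) :=
          Finset.sum_congr rfl fun T _ => hA.query_law N d hD I h p hl hp T
      _ = A.histProb I h := by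
          rw [← Finset.mul_sum, ← ENNReal.ofNNReal_finsetSum, I.sum_sampleProb]; simp
  -- both sides have the same finite sum over `s'`, so the inequality `hle` is an equality
  have heq : ∀ s', ∑ T, A.mass I (.query p T :: h) s' = q s' := by
    intro s'
    by_contra hne
    have hlt := ENNReal.tsum_lt_tsum (f := fun s' => ∑ T, A.mass I (.query p T :: h) s')
      (by rw [hsum]; exact ne_top_of_le_ne_top ENNReal.one_ne_top (A.histProb_le_one h)) hle
      (lt_of_le_of_ne (hle s') hne)
    rw [hsum] at hlt
    exact absurd (tsum_mul_finalMass_le (A.mass I h) A.query (setParams p)) (not_le.2 hlt)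
  rw [← Summable.tsum_finsetSum fun _ _ => ENNReal.summable]
  simp only [← Finset.sum_mul, heq, q, ← ENNReal.tsum_mul_left, ← ENNReal.tsum_mul_right]
  rw [ENNReal.tsum_comm]
  simp only [mul_assoc]

lemma Algorithm.tsum_delete (h : History F d N) (x : Fin N) (H : Store d → ℝ≥0∞) :
    ∑' s, A.mass I h s * ∑' s', finalMass A.delete (setItem F x s) s' * H s' =
      ∑' s', A.mass I (.delete x :: h) s' * H s' := by
  simp only [Algorithm.mass, ← ENNReal.tsum_mul_left, ← ENNReal.tsum_mul_right]
  rw [ENNReal.tsum_comm]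
  simp only [mul_assoc]

/-- A deletion takes at least one step. -/
lemma Algorithm.Solves.one_le_deletionTime (hA : A.Solves F D tp tq td) (hD : (N, d) ∈ D)
    (hN : 0 < N) (I : Items F d N) : 1 ≤ td N := by
  obtain ⟨s, hs⟩ := (hA.init_time N d hD I).exists_finalMass_ne_zero
  have := (hA.delete_time N d hD I [] ⟨0, hN⟩ trivial (Finset.mem_univ _) s hs).one_le
  exact Nat.one_le_floor_iff _ |>.1 this

end DPSS

/-! ### The items and the query parameters of the reduction -/

namespace WordRAM

open DPSS Cmd

variable {d N k : ℕ} {F : Format}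

/-- The items for the given keys: all mantissas are one. -/
def Keys.items (X : Keys F.indexWords k d N) (hexp : k + F.indexWords ≤ F.expWords)
    (hmant : 1 ≤ F.mantWords) : Items F d N where
  exp := X.expo
  mant := fun _ => 1
  exp_lt := fun i => (X.expo_lt i).trans_le
    (Nat.pow_le_pow_right (by norm_num) (Nat.mul_le_mul_left _ (by omega)))
  mant_lt := fun _ => Nat.one_lt_two_pow (Nat.mul_ne_zero X.pos.ne' (by omega))

/-- The parameters of all queries: `α = a / (2 * a + 1)` and `β = 1 / (2 * a + 1)`, where `2 * a + 1`
is the greatest word. -/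
def queryParams (F : Format) (hd : 0 < d) (hparam : 1 ≤ F.paramWords) : Params F d where
  aNum := (2 ^ d - 1) / 2
  aDen := 2 ^ d - 1
  bNum := 1
  bDen := 2 ^ d - 1
  aNum_lt := by
    have : 2 ^ d ≤ 2 ^ (d * F.paramWords) :=
      Nat.pow_le_pow_right (by norm_num) (Nat.le_mul_of_pos_right _ (by omega))
    have := Nat.one_lt_two_pow hd.ne'
    omega
  aDen_lt := by
    have : 2 ^ d ≤ 2 ^ (d * F.paramWords) :=
      Nat.pow_le_pow_right (by norm_num) (Nat.le_mul_of_pos_right _ (by omega))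
    have := Nat.one_lt_two_pow hd.ne'
    omega
  bNum_lt := Nat.one_lt_two_pow (Nat.mul_ne_zero hd.ne' (by omega))
  bDen_lt := by
    have : 2 ^ d ≤ 2 ^ (d * F.paramWords) :=
      Nat.pow_le_pow_right (by norm_num) (Nat.le_mul_of_pos_right _ (by omega))
    have := Nat.one_lt_two_pow hd.ne'
    omega
  aDen_pos := by have := Nat.one_lt_two_pow hd.ne'; omega
  bDen_pos := by have := Nat.one_lt_two_pow hd.ne'; omega

section Probabilities

variable {X : Keys F.indexWords k d N} {hexp : k + F.indexWords ≤ F.expWords}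
  {hmant : 1 ≤ F.mantWords} {hparam : 1 ≤ F.paramWords} {S : Finset (Fin N)}

lemma totalWeight_eq : (X.items hexp hmant).totalWeight S (queryParams F X.pos hparam) =
    (((2 ^ d - 1) / 2 * ∑ x ∈ S, 2 ^ X.expo x + 1 : ℕ) : ℝ≥0) / ((2 ^ d - 1 : ℕ) : ℝ≥0) := by
  simp only [Items.totalWeight, Params.alpha, Params.beta, queryParams, Items.weight, Keys.items]
  push_cast
  simp only [one_mul]
  rw [add_div, div_mul_eq_mul_div]

lemma totalWeight_pos : 0 < (X.items hexp hmant).totalWeight S (queryParams F X.pos hparam) := by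
  rw [totalWeight_eq]
  have := Nat.one_lt_two_pow X.pos.ne'
  refine div_pos ?_ ?_
  · exact_mod_cast Nat.succ_pos _
  · exact_mod_cast (by omega : 0 < 2 ^ d - 1)

/-- The item with the largest exponent is sampled with certainty: the exponents are distinct, so twice
its weight exceeds the sum of all weights, and `α < 1 / 2` leaves room for `β`. -/
lemma prob_max_eq_one {z : Fin N} (hz : ∀ x ∈ S, X.expo x ≤ X.expo z) :
    (X.items hexp hmant).prob S (queryParams F X.pos hparam) z = 1 := by
  refine min_eq_right ((one_le_div totalWeight_pos).2 ?_)
  have hd := Nat.one_lt_two_pow X.pos.ne'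
  have hsum : ∑ x ∈ S, 2 ^ X.expo x < 2 ^ (X.expo z + 1) := by
    have := Nat.geomSum_lt (m := 2) (s := S.image X.expo) (n := X.expo z + 1) le_rfl (by
      intro e he
      obtain ⟨x, hx, rfl⟩ := Finset.mem_image.1 he
      exact Nat.lt_succ_of_le (hz x hx))
    rwa [Finset.sum_image fun x _ y _ h => X.expo_injective h] at this
  have key : (2 ^ d - 1) / 2 * ∑ x ∈ S, 2 ^ X.expo x + 1 ≤ 2 ^ X.expo z * (2 ^ d - 1) := by
    have h1 : 2 * ((2 ^ d - 1) / 2) + 1 ≤ 2 ^ d - 1 := by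
      obtain ⟨e, he⟩ := Nat.exists_eq_succ_of_ne_zero X.pos.ne'
      have : 2 ^ d = 2 * 2 ^ e := by rw [he, pow_succ]; ring
      omega
    calc (2 ^ d - 1) / 2 * ∑ x ∈ S, 2 ^ X.expo x + 1
        ≤ (2 ^ d - 1) / 2 * 2 ^ (X.expo z + 1) + 2 ^ X.expo z := by
          have := Nat.mul_le_mul_left ((2 ^ d - 1) / 2) hsum.le
          have := Nat.one_le_two_pow (n := X.expo z)
          omega
      _ = 2 ^ X.expo z * (2 * ((2 ^ d - 1) / 2) + 1) := by rw [pow_succ]; ring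
      _ ≤ _ := Nat.mul_le_mul_left _ h1
  rw [totalWeight_eq, div_le_iff₀ (by exact_mod_cast (by omega : 0 < 2 ^ d - 1))]
  have : (X.items hexp hmant).weight z = ((2 ^ X.expo z : ℕ) : ℝ≥0) := by
    simp [Items.weight, Keys.items]
  rw [this]
  exact_mod_cast key

/-- The expected size of a sample is bounded.  If words have one bit, then `α = 0` and `β = 1`,
so all items are sampled, but there are less than `2 ^ F.indexWords` of them.  Otherwise `α ≥ 1 / 3`. -/
lemma mu_le : (X.items hexp hmant).mu S (queryParams F X.pos hparam) ≤
    2 ^ F.indexWords + 3 := by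
  have hd := Nat.one_lt_two_pow X.pos.ne'
  rcases Nat.eq_zero_or_pos ((2 ^ d - 1) / 2) with h0 | h0
  · have hd1 : d = 1 := by
      by_contra h
      have : 2 ^ 2 ≤ 2 ^ d := Nat.pow_le_pow_right (by norm_num) (by have := X.pos; omega)
      omega
    have hN : (N : ℝ≥0) ≤ 2 ^ F.indexWords := by
      have := X.card_lt
      rw [hd1, one_mul] at this
      exact_mod_cast this.le
    calc (X.items hexp hmant).mu S (queryParams F X.pos hparam) ≤ ∑ _x ∈ S, (1 : ℝ≥0) :=
          Finset.sum_le_sum fun x _ => min_le_right _ _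
      _ = S.card := by simp
      _ ≤ N := by exact_mod_cast (Finset.card_le_univ S).trans (by simp)
      _ ≤ 2 ^ F.indexWords + 3 := hN.trans le_self_add
  · refine le_add_left ?_
    set W := (X.items hexp hmant).totalWeight S (queryParams F X.pos hparam)
    calc (X.items hexp hmant).mu S (queryParams F X.pos hparam)
        ≤ ∑ x ∈ S, (X.items hexp hmant).weight x / W := Finset.sum_le_sum fun x _ => min_le_left _ _
      _ = (∑ x ∈ S, (X.items hexp hmant).weight x) / W := by rw [Finset.sum_div]
      _ ≤ 3 := by
        rw [div_le_iff₀ totalWeight_pos, totalWeight_eq, ← mul_div_assoc,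
          le_div_iff₀ (by exact_mod_cast (by omega : 0 < 2 ^ d - 1))]
        have hw : ∑ x ∈ S, (X.items hexp hmant).weight x = ((∑ x ∈ S, 2 ^ X.expo x : ℕ) : ℝ≥0) := by
          simp [Items.weight, Keys.items]
        rw [hw]
        have h3 : (∑ x ∈ S, 2 ^ X.expo x) * (2 ^ d - 1) ≤
            3 * ((2 ^ d - 1) / 2 * ∑ x ∈ S, 2 ^ X.expo x + 1) := by
          have : (∑ x ∈ S, 2 ^ X.expo x) * (2 ^ d - 1) ≤
              (∑ x ∈ S, 2 ^ X.expo x) * (3 * ((2 ^ d - 1) / 2)) :=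
            Nat.mul_le_mul_left _ (by omega)
          refine this.trans ?_
          rw [mul_add]
          refine le_add_right (le_of_eq ?_)
          ring
        exact_mod_cast h3

end Probabilities

/-- The `m` items with the smallest exponents. -/
noncomputable def Keys.lowest (X : Keys F.indexWords k d N) (m : ℕ) : Finset (Fin N) :=
  Finset.univ.filter fun x => (X.order.symm x : ℕ) < m

lemma Keys.lowest_all (X : Keys F.indexWords k d N) : X.lowest N = Finset.univ := by
  simp [lowest]

lemma Keys.order_mem_lowest (X : Keys F.indexWords k d N) (m : Fin N) :
    X.order m ∈ X.lowest (m + 1) := by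
  simp [lowest]

lemma Keys.lowest_erase (X : Keys F.indexWords k d N) (m : Fin N) :
    (X.lowest (m + 1)).erase (X.order m) = X.lowest m := by
  ext x
  have : x = X.order m ↔ (X.order.symm x : ℕ) = m := by
    rw [← Fin.ext_iff, Equiv.symm_apply_eq]
  simp only [lowest, Finset.mem_erase, Finset.mem_filter, Finset.mem_univ, true_and, ne_eq, this]
  omega

lemma Keys.expo_le_of_mem_lowest (X : Keys F.indexWords k d N) (m : Fin N) {x : Fin N}
    (hx : x ∈ X.lowest (m + 1)) : X.expo x ≤ X.expo (X.order m) := by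
  have := X.strictMono_order.monotone (a := X.order.symm x) (b := m) (by
    have : (X.order.symm x : ℕ) < m + 1 := by simpa [lowest] using hx
    exact Fin.le_def.2 (by omega))
  simpa using this

/-! ### Preprocessing -/

namespace Keys

variable {c : ℕ} (X : Keys c k d N)

/-- The input of the data structure as far as it is written when the items `n, …, N - 1` are
done. -/
def partialInput (n : ℕ) : Store d where
  reg := fun _ => 0
  mem := fun a =>
    if a.tbl = 0 then
      if a.row = [] then numWord d N a.col else 0
    else if h : a.row.length = c ∧ n ≤ rowVal a.row ∧ rowVal a.row < N then
      if a.tbl = 1 then numWord d (X.expo ⟨rowVal a.row, h.2.2⟩) a.col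
      else if a.tbl = 2 then numWord d 1 a.col else 0
    else 0

lemma initStore_items (X : Keys F.indexWords k d N) (hexp : k + F.indexWords ≤ F.expWords)
    (hmant : 1 ≤ F.mantWords) : (X.items hexp hmant).initStore = X.partialInput 0 := by
  refine Store.ext rfl (funext fun a => ?_)
  simp only [Items.initStore, inputStore, partialInput, items, Nat.zero_le, true_and]
  split_ifs <;> simp_all [numWord_zero_left]

lemma partialInput_succ {n : ℕ} (hn : n < N) {w v : ℕ → BitVec d}
    (hw : ∀ j < c + k, w j = numWord d (X.expo ⟨n, hn⟩) j) (hv : ∀ j < 1, v j = numWord d 1 j) :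
    ((X.partialInput (n + 1)).setRow 1 (c + k) (rowOf d c n) w).setRow 2 1 (rowOf d c n) v =
      X.partialInput n := by
  refine Store.ext rfl (funext fun a => ?_)
  obtain ⟨tbl, col, row⟩ := a
  simp only [Store.setRow_mem]
  by_cases hrow : row = rowOf d c n
  · subst hrow
    have hval := rowVal_rowOf (X.index_lt ⟨n, hn⟩)
    simp only at hval
    by_cases ht0 : tbl = 0
    · subst ht0; simp [partialInput]
    by_cases ht1 : tbl = 1
    · subst ht1
      by_cases hcol : col < c + k
      · simp [partialInput, hval, hn, hcol, hw]
      · simp [partialInput, hval, hn, hcol,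
          numWord_eq_zero (X.expo_lt ⟨n, hn⟩) (not_lt.1 hcol)]
    by_cases ht2 : tbl = 2
    · subst ht2
      by_cases hcol : col < 1
      · rw [if_pos ⟨rfl, hcol, rfl⟩, hv _ hcol]
        simp [partialInput, hval, hn]
      · rw [if_neg (by tauto), if_neg (by omega)]
        simp [partialInput, hval, hn, numWord_eq_zero (n := 1)
          (Nat.one_lt_two_pow (by have := X.pos; omega) : 1 < 2 ^ (d * 1)) (not_lt.1 hcol)]
    · simp [partialInput, ht0, ht1, ht2]
  · rw [if_neg (by tauto), if_neg (by tauto)]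
    have : row.length = c → rowVal row ≠ n := by
      rintro rfl rfl
      exact hrow (rowOf_rowVal row).symm
    have hiff : (row.length = c ∧ n + 1 ≤ rowVal row ∧ rowVal row < N) ↔
        (row.length = c ∧ n ≤ rowVal row ∧ rowVal row < N) := by
      constructor
      · rintro ⟨h1, h2, h3⟩; exact ⟨h1, by omega, h3⟩
      · rintro ⟨h1, h2, h3⟩; have := this h1; exact ⟨h1, by omega, h3⟩
    simp only [partialInput, hiff]

lemma partialInput_card {v : Store d} (hr : ∀ r, v.reg r = 0) (hm : ∀ a, v.mem a = 0)
    {w : ℕ → BitVec d} (hw : ∀ j < c, w j = numWord d N j) :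
    v.setRow 0 c [] w = X.partialInput N := by
  refine Store.ext (funext hr) (funext fun a => ?_)
  simp only [Store.setRow_mem, partialInput, hm]
  rw [dif_neg (by omega)]
  by_cases h0 : a.tbl = 0
  · by_cases h1 : a.row = []
    · by_cases h2 : a.col < c
      · simp [h0, h1, h2, hw]
      · simp [h0, h1, h2, numWord_eq_zero X.card_lt (not_lt.1 h2)]
    · simp [h0, h1]
  · simp [h0]

/-- The store on which the sorting program starts. -/
noncomputable def inStore : Store d := inputStore d c N fun t => if t = 1 then X.key else 0

lemma inStore_reg (r : ℕ) : X.inStore.reg r = 0 := rfl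

lemma inStore_card (j : ℕ) : X.inStore.mem ⟨0, j, []⟩ = numWord d N j := by
  simp [inStore, inputStore]

lemma inStore_key (i : Fin N) (j : ℕ) :
    X.inStore.mem ⟨1, j, rowOf d c i⟩ = numWord d (X.key i) j := by
  simp [inStore, inputStore, rowVal_rowOf (X.index_lt i)]

lemma inStore_guest_mem (a : Addr d) : X.inStore.guest.mem a = 0 := by
  simp only [inStore, inputStore, Store.guest, Addr.host]
  rw [if_neg (by omega)]
  split_ifs with h₁ h₂
  · omega
  · exact numWord_zero_left _ _
  · rfl

variable {X}

lemma det_setConsts : ∃ s, Det setConsts X.inStore 3 s ∧ X.Ready s ∧ s.guest = X.inStore.guest := by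
  set s₁ := X.inStore.setReg rOne (BitVec.ofNat d 1) with hs₁
  set s₂ := s₁.setReg rOnes (UnOp.not.eval (s₁.reg rZero)) with hs₂
  set s₃ := s₂.setReg rHalf (BinOp.shr.eval (s₂.reg rOnes) (s₂.reg rOne)) with hs₃
  refine ⟨s₃, (Det.const _ _ _).seq ((Det.un s₁ .not _ _).seq (Det.bin s₂ .shr _ _ _)),
    ⟨⟨?_, ?_, ?_, ?_⟩, fun j _ => X.inStore_card j, fun i j _ => X.inStore_key i j⟩, ?_⟩
  · simp [hs₃, hs₂, hs₁, Store.setReg_slot, inStore_reg]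
  · simp [hs₃, hs₂, hs₁, Store.setReg_slot]
  · simp [hs₃, hs₂, hs₁, Store.setReg_slot, inStore_reg, UnOp.eval]
  · simp [hs₃, hs₂, hs₁, Store.setReg_slot, inStore_reg, UnOp.eval, BinOp.eval]
  · simp [hs₃, hs₂, hs₁]

/-- The invariant of the loop that writes the items. -/
def WriteInv (X : Keys c k d N) (n : ℕ) (s : Store d) : Prop :=
  X.Ready s ∧ s.Holds 1 c n ∧ s.guest = X.partialInput n

lemma det_writeItem {n : ℕ} {s : Store d} (hn : n < N) (h : WriteInv X (n + 1) s) :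
    ∃ s', Det (writeItem c k) ((s.setArr 1 c (numWord d n)).setReg rFlag 1) (c + 2 * k + 1) s' ∧
      WriteInv X n s' := by
  obtain ⟨hR, -, hg⟩ := h
  set s₁ := (s.setArr 1 c (numWord d n)).setReg rFlag 1 with hs₁
  have r1 : X.Ready s₁ := (hR.setArr (by norm_num) (by norm_num) _ _).setFlag _
  have c1 : s₁.Holds 1 c n := by
    rw [hs₁, Store.holds_setReg (by norm_num) (by norm_num), Store.holds_setArr (by norm_num)]
    exact fun _ _ => rfl
  have g1 : s₁.guest = X.partialInput (n + 1) := by rw [hs₁]; simpa using hg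
  set s₂ := s₁.setArr 4 k fun j => s₁.mem ⟨1, j, (slots 1 c).map s₁.reg⟩ with hs₂
  have d2 : Det (loadArr 4 k 1 (slots 1 c)) s₁ k s₂ := Det.loadArr (by norm_num) _ _
    fun j w => Store.map_slots_setArr _ _ _ (by norm_num) (by norm_num) (by norm_num) _
  have r2 : X.Ready s₂ := r1.setArr (by norm_num) (by norm_num) _ _
  have k2 : s₂.Holds 4 k (X.key ⟨n, hn⟩) := by
    rw [hs₂, Store.holds_setArr (by norm_num), c1.map_slots]
    exact r1.2.2 ⟨n, hn⟩
  have c2 : s₂.Holds 1 c n := by simpa [hs₂] using c1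
  have d3 := Det.storeRow s₂ (1 + 3) (c + k) (slots 1 c)
    fun j => if j < c then slot 1 j else slot 4 (j - c)
  set s₃ := s₂.setRow (1 + 3) (c + k) ((slots 1 c).map s₂.reg)
    fun j => s₂.reg (if j < c then slot 1 j else slot 4 (j - c)) with hs₃
  have r3 : X.Ready s₃ := r2.setRow (by norm_num) _ _ _
  have c3 : s₃.Holds 1 c n := c2
  have d4 := Det.storeRow s₃ (2 + 3) 1 (slots 1 c) fun _ => rOne
  set s₄ := s₃.setRow (2 + 3) 1 ((slots 1 c).map s₃.reg) fun j => s₃.reg rOne with hs₄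
  refine ⟨s₄, (d2.seq (d3.seq d4)).mono (by omega), r3.setRow (by norm_num) _ _ _, c3, ?_⟩
  rw [hs₄, Store.setRow_guest, c3.map_slots, hs₃, Store.setRow_guest, c2.map_slots, hs₂,
    Store.setArr_guest, g1]
  refine X.partialInput_succ hn (fun j hj => ?_) fun j hj => ?_
  · by_cases hjc : j < c
    · rw [if_pos hjc]
      exact (c2 j hjc).trans (numWord_add_mul_of_lt hjc).symm
    · rw [if_neg hjc]
      refine (k2 (j - c) (by omega)).trans ?_
      have := numWord_add_mul_of_le (d := d) (a := X.key ⟨n, hn⟩) (X.index_lt ⟨n, hn⟩) (j - c)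
      rw [show c + (j - c) = j by omega] at this
      exact this.symm
  · obtain rfl : j = 0 := by omega
    change s₃.reg rOne = _
    rw [r3.1.one]; simp [numWord]

lemma det_writeItems : ∃ s, Det (writeItems c k) X.inStore ((N + 1) * (7 * c + 2 * k + 7)) s ∧
    X.Progress N s ∧ s.Holds 1 c N ∧ s.guest = X.partialInput 0 := by
  obtain ⟨s₁, d1, r1, g1⟩ := det_setConsts (X := X)
  have d2 : Det (loadArr 1 c 0 []) s₁ c _ := Det.loadArr (by norm_num) _ _ fun _ _ => rfl
  set s₂ := s₁.setArr 1 c fun j => s₁.mem ⟨0, j, [].map s₁.reg⟩ with hs₂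
  have r2 : X.Ready s₂ := r1.setArr (by norm_num) (by norm_num) _ _
  have c2 : s₂.Holds 1 c N := by
    rw [hs₂, Store.holds_setArr (by norm_num)]; exact r1.2.1
  have d3 := Det.storeRow s₂ (0 + 3) c [] (slot 1)
  set s₃ := s₂.setRow (0 + 3) c ([].map s₂.reg) fun j => s₂.reg (slot 1 j) with hs₃
  have h3 : WriteInv X N s₃ := by
    refine ⟨r2.setRow (by norm_num) _ _ _, c2, ?_⟩
    rw [hs₃, Store.setRow_guest, hs₂, Store.setArr_guest, g1, ← hs₂]
    exact X.partialInput_card (fun _ => rfl) X.inStore_guest_mem c2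
  obtain ⟨s₄, w, ⟨r4, -, g4⟩, d4⟩ := Det.loopDown (g := 1) (by norm_num) (by norm_num) X.pos
    (writeItem c k) _ (WriteInv X) X.card_lt (fun n s h => ⟨h.2.1, h.1.1⟩)
    (fun n s hn h => det_writeItem hn h) h3
  set s₅ := (s₄.setArr 1 c w).setReg rFlag 0 with hs₅
  have r5 : X.Ready s₅ := (r4.setArr (by norm_num) (by norm_num) _ _).setFlag _
  have d6 : Det (loadArr 1 c 0 []) s₅ c _ := Det.loadArr (by norm_num) _ _ fun _ _ => rfl
  refine ⟨_, (d1.seq (d2.seq (d3.seq (d4.seq d6)))).mono ?_,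
    (r5.setArr (g := 1) (by norm_num) (by norm_num) _ _).progress, ?_, ?_⟩
  · have h1 : (N + 1) * (3 * c + 3 + (c + 2 * k + 1)) + (N + 1) * (3 * c + 3) =
        (N + 1) * (7 * c + 2 * k + 7) := by ring
    have h2 : 3 * c + 3 ≤ (N + 1) * (3 * c + 3) := Nat.le_mul_of_pos_left _ (by omega)
    omega
  · rw [Store.holds_setArr (by norm_num)]; exact r5.2.1
  · rw [Store.setArr_guest, hs₅, Store.setReg_guest, Store.setArr_guest, g4]

/-! ### Queries and deletions -/

lemma det_writeParam {s : Store d} {m : ℕ} (hP : X.Progress m s) {tbl : ℕ} (pw : ℕ) {r x : ℕ}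
    (hx : x < 2 ^ d) (hr : (s.reg r).toNat = x) :
    ∃ s', Det (writeParam (tbl + 3) pw r) s pw s' ∧ X.Progress m s' ∧ s'.reg = s.reg ∧
      s'.guest = s.guest.writeNum tbl pw x := by
  refine ⟨_, Det.storeRow _ _ _ _ _, hP.setRow (by omega) _ _ _, rfl, ?_⟩
  rw [Store.setRow_guest, Store.writeNum_eq]
  refine Store.setRow_congr fun j _ => ?_
  split_ifs with hj
  · subst hj
    apply BitVec.eq_of_toNat_eq
    rw [toNat_numWord, hr]; simp [Nat.mod_eq_of_lt hx]
  · rw [hP.1.1.zero, numWord_eq_zero (n := 1) (by rwa [mul_one]) (by omega)]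

lemma det_writeParams (hparam : 1 ≤ F.paramWords) {s : Store d} {m n : ℕ} (hP : X.Progress m s)
    (hc : s.Holds 1 c n) :
    ∃ s', Det (writeParams F.paramWords) s (4 * F.paramWords) s' ∧ X.Progress m s' ∧
      s'.Holds 1 c n ∧ s'.guest = setParams (queryParams F X.pos hparam) s.guest := by
  have hd := Nat.one_lt_two_pow X.pos.ne'
  have hones : (s.reg rOnes).toNat = 2 ^ d - 1 := by rw [hP.1.1.ones]; simp
  have hone : (s.reg rOne).toNat = 1 := by rw [hP.1.1.one]; simp [Nat.mod_eq_of_lt hd]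
  have hhalf : (s.reg rHalf).toNat = (2 ^ d - 1) / 2 := by
    rw [hP.1.1.half]
    simp [Nat.mod_eq_of_lt hd, Nat.shiftRight_eq_div_pow]
  obtain ⟨s₁, d1, p1, e1, g1⟩ := det_writeParam hP (tbl := 4) F.paramWords (r := rHalf)
    (by omega) hhalf
  obtain ⟨s₂, d2, p2, e2, g2⟩ := det_writeParam p1 (tbl := 5) F.paramWords (r := rOnes)
    (x := 2 ^ d - 1) (by omega) (by rw [e1, hones])
  obtain ⟨s₃, d3, p3, e3, g3⟩ := det_writeParam p2 (tbl := 6) F.paramWords (r := rOne)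
    (x := 1) (by omega) (by rw [e2, e1, hone])
  obtain ⟨s₄, d4, p4, e4, g4⟩ := det_writeParam p3 (tbl := 7) F.paramWords (r := rOnes)
    (x := 2 ^ d - 1) (by omega) (by rw [e3, e2, e1, hones])
  refine ⟨s₄, (d1.seq (d2.seq (d3.seq d4))).mono (by omega), p4, ?_, ?_⟩
  · intro j hj; rw [e4, e3, e2, e1]; exact hc j hj
  · rw [g4, g3, g2, g1]; rfl

lemma det_writeOutput {s : Store d} {X : Keys F.indexWords k d N} {m : Fin N}
    (hP : X.Progress (m + 1) s) (hc : s.Holds 1 F.indexWords m)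
    (h5 : s.Holds 5 F.indexWords (X.order m)) (h6 : s.Holds 6 k (X.key (X.order m))) :
    ∃ s', Det (writeOutput F.indexWords k) s (k + F.indexWords) s' ∧ X.Progress m s' ∧
      s'.Holds 1 F.indexWords m ∧ s'.guest = setItem F (X.order m) s.guest := by
  set s₁ := s.setRow 2 k ((slots 1 F.indexWords).map s.reg) fun j => s.reg (slot 6 j) with hs₁
  have d1 : Det _ s k s₁ := Det.storeRow s 2 k (slots 1 F.indexWords) (slot 6)
  have r1 : X.Ready s₁ := hP.1.setRow le_rfl _ _ _
  have p1 : X.Progress m s₁ := by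
    refine ⟨r1, fun i hi j hj => ?_⟩
    rw [hs₁, Store.setRow_mem, hc.map_slots]
    by_cases him : i = m
    · subst him
      rw [if_pos ⟨rfl, hj, rfl⟩]
      exact h6 j hj
    · have hne : (m : ℕ) ≠ i := fun h => him (Fin.ext h.symm)
      rw [if_neg (by
        rintro ⟨-, -, h⟩
        exact hne (rowOf_inj (X.index_lt i) (X.index_lt m) h).symm)]
      exact hP.2 i (by omega) j hj
  have d2 := Det.storeRow s₁ (3 + 3) F.indexWords [] (slot 5)
  refine ⟨_, d1.seq d2, p1.setRow (by norm_num) _ _ _, hc, ?_⟩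
  rw [Store.setRow_guest, hs₁, Store.setRow_guest_of_lt _ (by norm_num), setItem, Store.writeNum_eq]
  exact Store.setRow_congr h5

end Keys

end WordRAM

/-! ### The expected time of the sorting program -/

namespace WordRAM

open DPSS Cmd

variable {d N k : ℕ} {F : Format}

open Classical in
/-- An infinite payment for a wrong output. -/
noncomputable def penalty (X : Keys F.indexWords k d N) (s : Store d) : ℝ≥0∞ :=
  if IsSortedOutput F.indexWords k X.key s then 0 else ⊤

/-- The cost of the main loop of the sorting program, and of halting after it. -/
noncomputable def mainCost (X : Keys F.indexWords k d N) (A : Algorithm) : Store d → ℝ≥0∞ :=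
  loopCost 1 F.indexWords (extractMax F.indexWords k F.paramWords A) fun s => 1 + penalty X s

/-- The largest cost of the main loop when `m` items are left and the data structure has the
store `v`. -/
noncomputable def remainingCost (X : Keys F.indexWords k d N) (A : Algorithm) (m : ℕ)
    (v : Store d) : ℝ≥0∞ :=
  ⨆ (s : Store d) (_ : X.Progress m s ∧ s.Holds 1 F.indexWords m ∧ s.guest = v), mainCost X A s

/-- The largest cost of the main loop from the point after a query, when `m + 1` items are left and
the data structure has the store `v`. -/
noncomputable def answeredCost (X : Keys F.indexWords k d N) (A : Algorithm) (m : ℕ)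
    (v : Store d) : ℝ≥0∞ :=
  ⨆ (s : Store d) (_ : X.Progress (m + 1) s ∧ s.Holds 1 F.indexWords m ∧ s.guest = v),
    (seq (selectMax F.indexWords k) (seq (writeOutput F.indexWords k) (call A.delete))).wp
      (mainCost X A) s

variable {X : Keys F.indexWords k d N} {A : Algorithm}

lemma mainCost_le_remainingCost {m : ℕ} {s : Store d} (hP : X.Progress m s)
    (hc : s.Holds 1 F.indexWords m) : mainCost X A s ≤ remainingCost X A m s.guest :=
  le_iSup₂_of_le (f := fun (s' : Store d)
    (_ : X.Progress m s' ∧ s'.Holds 1 F.indexWords m ∧ s'.guest = s.guest) => mainCost X A s')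
    s ⟨hP, hc, rfl⟩ le_rfl

lemma remainingCost_zero_le (v : Store d) :
    remainingCost X A 0 v ≤ ((3 * F.indexWords + 4 : ℕ) : ℝ≥0∞) := by
  refine iSup₂_le fun s ⟨hP, hc, _⟩ => ?_
  obtain ⟨w, hw⟩ := loopCost_zero_le (by norm_num) (by norm_num) hP.1.1 hc
  refine (hw _ _).trans ?_
  have : IsSortedOutput F.indexWords k X.key ((s.setArr 1 F.indexWords w).setReg rFlag 0) :=
    ((hP.setArr (by norm_num) (by norm_num) _ _).setFlag _).isSortedOutput
  rw [penalty, if_pos this]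
  push_cast
  rw [add_zero, add_assoc]
  norm_num

lemma remainingCost_succ_le (hparam : 1 ≤ F.paramWords) (m : Fin N) (v : Store d) :
    remainingCost X A (m + 1) v ≤ ((3 * F.indexWords + 3 + 4 * F.paramWords : ℕ) : ℝ≥0∞) +
      (expectedTime A.query (setParams (queryParams F X.pos hparam) v) +
        ∑' v', finalMass A.query (setParams (queryParams F X.pos hparam) v) v' *
          answeredCost X A m v') := by
  refine iSup₂_le fun s ⟨hP, hc, hg⟩ => ?_
  refine (loopCost_succ_le (by norm_num) (by norm_num) hP.1.1 X.pos
    (lt_of_le_of_lt (by omega) X.card_lt) hc _ _).trans ?_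
  set s₁ := (s.setArr 1 F.indexWords (numWord d m)).setReg rFlag 1 with hs₁
  have p1 : X.Progress (m + 1) s₁ := (hP.setArr (by norm_num) (by norm_num) _ _).setFlag _
  have c1 : s₁.Holds 1 F.indexWords m := by
    rw [hs₁, Store.holds_setReg (by norm_num) (by norm_num), Store.holds_setArr (by norm_num)]
    exact fun _ _ => rfl
  obtain ⟨s₂, d2, p2, c2, g2⟩ := Keys.det_writeParams hparam p1 c1
  have hg2 : s₂.guest = setParams (queryParams F X.pos hparam) v := by
    rw [g2, hs₁, Store.setReg_guest, Store.setArr_guest, hg]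
  rw [Nat.cast_add _ (4 * F.paramWords), add_assoc]
  gcongr
  refine (wp_seq _ _ _ _).trans ((d2 _).trans ?_)
  gcongr
  refine (wp_seq _ _ _ _).trans ((wp_call _ _ _).trans ?_)
  rw [hg2]
  gcongr with v'
  exact le_iSup₂_of_le (f := fun (s : Store d)
    (_ : X.Progress (m + 1) s ∧ s.Holds 1 F.indexWords m ∧ s.guest = v') =>
      (seq (selectMax F.indexWords k) (seq (writeOutput F.indexWords k) (call A.delete))).wp
      (mainCost X A) s) (s₂.withGuest v')
    ⟨p2.withGuest _, Store.holds_withGuest.2 c2, guest_withGuest _ _⟩ le_rfl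

lemma answeredCost_le {m : Fin N} {v : Store d} {T : Finset (Fin N)} (hT : Returns F v T)
    (hm : X.order m ∈ T) (hmax : ∀ x ∈ T, X.expo x ≤ X.expo (X.order m)) :
    answeredCost X A m v ≤
      (((T.card + 1) * (20 * (F.indexWords + k) + 20) + (k + F.indexWords) : ℕ) : ℝ≥0∞) +
      (expectedTime A.delete (setItem F (X.order m) v) +
        ∑' v', finalMass A.delete (setItem F (X.order m) v) v' * remainingCost X A m v') := by
  refine iSup₂_le fun s ⟨hP, hc, hg⟩ => ?_
  obtain ⟨l, hnd, rfl, hsize, hv⟩ := hT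
  obtain ⟨s₁, d1, p1, c1, g1, h5, h6⟩ := det_selectMax hsize hv (by simpa using hm)
    (by simpa using hmax) hP hc hg
  obtain ⟨s₂, d2, p2, c2, g2⟩ := Keys.det_writeOutput p1 c1 h5 h6
  rw [List.toFinset_card_of_nodup hnd, Nat.cast_add _ (k + F.indexWords), add_assoc]
  refine (wp_seq _ _ _ _).trans ((d1 _).trans ?_)
  gcongr
  refine (wp_seq _ _ _ _).trans ((d2 _).trans ?_)
  gcongr
  refine (wp_call _ _ _).trans ?_
  rw [g2, g1]
  gcongr with v'
  have := mainCost_le_remainingCost (A := A) (p2.withGuest v') (Store.holds_withGuest.2 c2)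
  rwa [guest_withGuest] at this

/-- A bound for the expected cost of one round of the main loop. -/
noncomputable def roundCost (F : Format) (k : ℕ) (tq td : ℝ≥0) : ℝ≥0 :=
  (3 * F.indexWords + 3 + 4 * F.paramWords : ℕ) + (1 + (2 ^ F.indexWords + 3)) * tq +
    ((2 ^ F.indexWords + 3) * (20 * (F.indexWords + k) + 20 : ℕ) +
      ((20 * (F.indexWords + k) + 20 : ℕ) + (k + F.indexWords : ℕ) + td))

variable {D : Set (ℕ × ℕ)} {tp tq td : ℕ → ℝ≥0} {hexp : k + F.indexWords ≤ F.expWords}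
  {hmant : 1 ≤ F.mantWords}

/-- The expected cost of the rest of the loop for a fixed query result; the bound `B` for the later
rounds is given. -/
lemma tsum_answeredCost_le (hparam : 1 ≤ F.paramWords) (hA : A.Solves F D tp tq td)
    (hD : (N, d) ∈ D) (m : Fin N) {B : ℝ≥0}
    {h : History F d N} (hl : Legal (X.items hexp hmant) h) (hlive : live h = X.lowest (m + 1))
    (hB : ∀ h', Legal (X.items hexp hmant) h' → live h' = X.lowest m →
      ∑' v, A.mass (X.items hexp hmant) h' v * remainingCost X A m v ≤
        A.histProb (X.items hexp hmant) h' * (B : ℝ≥0∞)) (T : Finset (Fin N)) :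
    ∑' v, A.mass (X.items hexp hmant) (.query (queryParams F X.pos hparam) T :: h) v *
        answeredCost X A m v ≤
      A.histProb (X.items hexp hmant) h *
        (((X.items hexp hmant).sampleProb (live h) (queryParams F X.pos hparam) T *
          (T.card * (20 * (F.indexWords + k) + 20 : ℕ) +
            ((20 * (F.indexWords + k) + 20 : ℕ) + (k + F.indexWords : ℕ) + td N + B)) : ℝ≥0) :
          ℝ≥0∞) := by
  set I := X.items hexp hmant with hI
  set p := queryParams F X.pos hparam with hp
  have hpos : 0 < I.totalWeight (live h) p := totalWeight_pos
  have hlaw := hA.query_law N d hD I h p hl hpos T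
  by_cases h0 : I.sampleProb (live h) p T = 0
  · rw [h0, ENNReal.coe_zero, mul_zero] at hlaw
    have : ∀ v, A.mass I (.query p T :: h) v = 0 := ENNReal.tsum_eq_zero.1 hlaw
    simp [this]
  have hsub := Items.subset_of_sampleProb_ne_zero h0
  have hmem : X.order m ∈ T := Items.mem_of_prob_eq_one h0
    (by rw [hlive]; exact X.order_mem_lowest m) (prob_max_eq_one fun x hx => by
      rw [hlive] at hx; exact X.expo_le_of_mem_lowest m hx)
  have hmax : ∀ x ∈ T, X.expo x ≤ X.expo (X.order m) := fun x hx =>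
    X.expo_le_of_mem_lowest m (hlive ▸ hsub hx)
  have hl' : Legal I (.query p T :: h) := ⟨hl, hpos⟩
  have hlive' : X.order m ∈ live (.query p T :: h : History F d N) := by
    change X.order m ∈ live h
    rw [hlive]; exact X.order_mem_lowest m
  set κ : ℕ := (T.card + 1) * (20 * (F.indexWords + k) + 20) + (k + F.indexWords) with hκ
  calc ∑' v, A.mass I (.query p T :: h) v * answeredCost X A m v
      ≤ ∑' v, (A.mass I (.query p T :: h) v * ((κ : ℝ≥0∞) + (td N : ℝ≥0∞)) +
          A.mass I (.query p T :: h) v * ∑' v', finalMass A.delete (setItem F (X.order m) v) v' *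
            remainingCost X A m v') := by
        refine ENNReal.tsum_le_tsum fun v => ?_
        by_cases hv : A.mass I (.query p T :: h) v = 0
        · simp [hv]
        have hR : Returns F v T := by
          by_contra hR
          exact hv (by simp only [Algorithm.mass]; exact if_neg hR)
        have ht := (hA.delete_time N d hD I _ _ hl' hlive' v hv).expectedTime_le
        have ht' : expectedTime A.delete (setItem F (X.order m) v) ≤ (td N : ℝ≥0∞) := by
          refine ht.trans ?_
          exact_mod_cast Nat.floor_le (zero_le (a := td N))
        rw [← mul_add]
        gcongr
        refine (answeredCost_le hR hmem hmax).trans ?_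
        rw [← add_assoc]
        gcongr
    _ = A.histProb I (.query p T :: h) * ((κ : ℝ≥0∞) + (td N : ℝ≥0∞)) +
          ∑' v, A.mass I (.delete (X.order m) :: .query p T :: h) v * remainingCost X A m v := by
        rw [ENNReal.tsum_add, ENNReal.tsum_mul_right, A.tsum_delete]; rfl
    _ ≤ A.histProb I (.query p T :: h) * ((κ : ℝ≥0∞) + (td N : ℝ≥0∞)) +
          A.histProb I (.query p T :: h) * (B : ℝ≥0∞) := by
        gcongr
        refine (hB (.delete (X.order m) :: .query p T :: h) ⟨hl', hlive'⟩ ?_).trans ?_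
        · change (live h).erase (X.order m) = _
          rw [hlive, X.lowest_erase]
        · gcongr
          exact A.histProb_delete_le _ _
    _ = _ := by
        rw [hlaw, ← mul_add, mul_assoc]
        congr 1
        rw [hκ]
        push_cast
        ring

/-- The expected cost of the main loop, given any history after which the `m` items with the
smallest exponents are left. -/
lemma tsum_remainingCost_le (hparam : 1 ≤ F.paramWords) (hA : A.Solves F D tp tq td)
    (hD : (N, d) ∈ D) (m : ℕ) (hm : m ≤ N) (h : History F d N)
    (hl : Legal (X.items hexp hmant) h) (hlive : live h = X.lowest m) :
    ∑' v, A.mass (X.items hexp hmant) h v * remainingCost X A m v ≤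
      A.histProb (X.items hexp hmant) h *
        (((3 * F.indexWords + 4 : ℕ) + m * roundCost F k (tq N) (td N) : ℝ≥0) : ℝ≥0∞) := by
  induction m generalizing h with
  | zero =>
    rw [Algorithm.histProb, ← ENNReal.tsum_mul_right]
    refine ENNReal.tsum_le_tsum fun v => ?_
    gcongr
    refine (remainingCost_zero_le v).trans ?_
    simp
  | succ m ih =>
    set I := X.items hexp hmant with hI
    set p := queryParams F X.pos hparam with hp
    set B : ℝ≥0 := (3 * F.indexWords + 4 : ℕ) + m * roundCost F k (tq N) (td N) with hBdef
    have hpos : 0 < I.totalWeight (live h) p := totalWeight_pos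
    set K₁ : ℕ := 3 * F.indexWords + 3 + 4 * F.paramWords with hK₁
    set K₂ : ℕ := 20 * (F.indexWords + k) + 20 with hK₂
    set K₃ : ℕ := k + F.indexWords with hK₃
    have hT := tsum_answeredCost_le (X := X) hparam hA hD ⟨m, hm⟩ hl hlive
      (fun h' => ih (by omega) h')
    calc ∑' v, A.mass I h v * remainingCost X A (m + 1) v
        ≤ ∑' v, (A.mass I h v * (K₁ : ℝ≥0∞) + A.mass I h v * expectedTime A.query (setParams p v) +
            A.mass I h v * ∑' v', finalMass A.query (setParams p v) v' * answeredCost X A m v') := by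
          refine ENNReal.tsum_le_tsum fun v => ?_
          rw [← mul_add, ← mul_add, add_assoc]
          gcongr
          exact remainingCost_succ_le hparam ⟨m, hm⟩ v
      _ = A.histProb I h * (K₁ : ℝ≥0∞) +
            ∑' v, A.mass I h v * expectedTime A.query (setParams p v) +
            ∑ T, ∑' v, A.mass I (.query p T :: h) v * answeredCost X A m v := by
          rw [ENNReal.tsum_add, ENNReal.tsum_add, ENNReal.tsum_mul_right,
            hA.tsum_query hD hl hpos]; rfl
      _ ≤ A.histProb I h * (K₁ : ℝ≥0∞) +
            A.histProb I h * (((1 + I.mu (live h) p) * tq N : ℝ≥0) : ℝ≥0∞) +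
            ∑ T, A.histProb I h * ((I.sampleProb (live h) p T *
              (T.card * K₂ + (K₂ + K₃ + td N + B)) : ℝ≥0) : ℝ≥0∞) := by
          gcongr with T
          · exact hA.query_time N d hD I h p hl hpos
          · exact hT T
      _ = A.histProb I h * ((K₁ + (1 + I.mu (live h) p) * tq N +
            (I.mu (live h) p * K₂ + (K₂ + K₃ + td N + B)) : ℝ≥0) : ℝ≥0∞) := by
          rw [← Finset.mul_sum, ← ENNReal.ofNNReal_finsetSum, ← I.sum_sampleProb_mul_card]
          have : ∑ T, I.sampleProb (live h) p T * (T.card * K₂ + (K₂ + K₃ + td N + B)) =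
              (∑ T, I.sampleProb (live h) p T * T.card) * K₂ + (K₂ + K₃ + td N + B) := by
            simp only [mul_add (I.sampleProb (live h) p _) (_ * _), Finset.sum_add_distrib,
              ← Finset.sum_mul, I.sum_sampleProb, one_mul, ← mul_assoc]
          rw [this]
          push_cast
          ring
      _ ≤ _ := by
          refine mul_le_mul' le_rfl (ENNReal.coe_le_coe.2 ?_)
          have hmu : I.mu (live h) p ≤ 2 ^ F.indexWords + 3 := mu_le
          calc K₁ + (1 + I.mu (live h) p) * tq N + (I.mu (live h) p * K₂ + (K₂ + K₃ + td N + B))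
              ≤ K₁ + (1 + (2 ^ F.indexWords + 3)) * tq N +
                ((2 ^ F.indexWords + 3) * K₂ + (K₂ + K₃ + td N + B)) := by gcongr
            _ = _ := by
              rw [hBdef, roundCost, hK₁, hK₂, hK₃]
              push_cast
              ring

/-- The factor in the time bound. -/
noncomputable def timeFactor (F : Format) (k : ℕ) : ℝ≥0 :=
  2 * (7 * F.indexWords + 2 * k + 7 : ℕ) + (3 * F.indexWords + 4 : ℕ) + roundCost F k 1 1

lemma totalTime_le {n : ℕ} (hn : 1 ≤ n) {tp tq td : ℝ≥0} (htd : 1 ≤ td) :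
    ((n + 1) * (7 * F.indexWords + 2 * k + 7) : ℕ) + (tp + ((3 * F.indexWords + 4 : ℕ) +
      n * roundCost F k tq td)) ≤ tp + timeFactor F k * (n * (tq + td)) := by
  have hr : roundCost F k tq td ≤ roundCost F k 1 1 * (tq + td) := by
    have h1 : 1 ≤ tq + td := htd.trans le_add_self
    have hmul : ∀ x : ℝ≥0, x ≤ x * (tq + td) := fun x => le_mul_of_one_le_right zero_le h1
    unfold roundCost
    refine (add_le_add (add_le_add (hmul _) (mul_le_mul' le_rfl (le_self_add (b := td))))
      (add_le_add (hmul _) (add_le_add (add_le_add (hmul _) (hmul _))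
        (le_add_self (b := tq))))).trans (le_of_eq ?_)
    ring
  have hn' : (1 : ℝ≥0) ≤ n := by exact_mod_cast hn
  have h1 : 1 ≤ (n : ℝ≥0) * (tq + td) := one_le_mul hn' (htd.trans le_add_self)
  have h2 : (n : ℝ≥0) ≤ n * (tq + td) :=
    le_mul_of_one_le_right zero_le (htd.trans le_add_self)
  set U : ℝ≥0 := ((7 * F.indexWords + 2 * k + 7 : ℕ) : ℝ≥0) with hU
  set V : ℝ≥0 := ((3 * F.indexWords + 4 : ℕ) : ℝ≥0)
  set R := roundCost F k 1 1
  calc (((n + 1) * (7 * F.indexWords + 2 * k + 7) : ℕ) : ℝ≥0) + (tp + (V + n * roundCost F k tq td))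
      = tp + ((n + 1) * U + V + n * roundCost F k tq td) := by
        rw [hU]; push_cast; ring
    _ ≤ tp + ((n * (tq + td) + n * (tq + td)) * U + V * (n * (tq + td)) +
          n * (R * (tq + td))) := by
        gcongr
        exact le_mul_of_one_le_right zero_le h1
    _ = tp + timeFactor F k * (n * (tq + td)) := by
        simp only [timeFactor, U, V, R]; ring

lemma cost_sorter_le (hparam : 1 ≤ F.paramWords) (hexp : k + F.indexWords ≤ F.expWords)
    (hmant : 1 ≤ F.mantWords) (hA : A.Solves F D tp tq td) (hD : (N, d) ∈ D) (hN : 1 ≤ N) :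
    cost ((sorter F.indexWords k F.paramWords A).code 0) (penalty X) (start X.inStore) ≤
      ((tp N + timeFactor F k * (N * (tq N + td N)) : ℝ≥0) : ℝ≥0∞) := by
  obtain ⟨s, d1, p1, c1, g1⟩ := Keys.det_writeItems (X := X)
  set I := X.items hexp hmant with hI
  rw [← X.initStore_items hexp hmant, ← hI] at g1
  refine le_trans ?_ (ENNReal.coe_le_coe.2 (totalTime_le (F := F) (k := k) (tp := tp N)
    (tq := tq N) hN (hA.one_le_deletionTime hD hN I)))
  refine (cost_code_le _ _ _).trans ((wp_seq _ _ _ _).trans ((d1 _).trans ?_))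
  rw [ENNReal.coe_add, ENNReal.coe_natCast, ENNReal.coe_add]
  gcongr
  refine (wp_seq _ _ _ _).trans ((wp_call _ _ _).trans ?_)
  rw [g1]
  gcongr
  · refine (hA.init_time N d hD I).expectedTime_le.trans ?_
    exact_mod_cast Nat.floor_le (zero_le (a := tp N))
  · have hbound := tsum_remainingCost_le (X := X) (hexp := hexp) (hmant := hmant) hparam hA hD N
      le_rfl [] trivial (by rw [X.lowest_all]; rfl)
    refine le_trans ?_ (hbound.trans (le_trans (mul_le_mul_left (A.histProb_le_one _) _)
      (one_mul _).le))
    refine ENNReal.tsum_le_tsum fun v => ?_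
    change _ ≤ finalMass A.init I.initStore v * _
    gcongr
    refine (wp_loopDown_le _ _ _ _ _).trans ?_
    have := mainCost_le_remainingCost (A := A) (p1.withGuest v) (Store.holds_withGuest.2 c1)
    rwa [guest_withGuest] at this

end WordRAM

theorem theorem2 (F : DPSS.Format) (k : ℕ) (hexp : k + F.indexWords ≤ F.expWords)
    (hmant : 1 ≤ F.mantWords) (hparam : 1 ≤ F.paramWords) :
    ∃ C : ℝ≥0, ∀ D : Set (ℕ × ℕ),
      (∀ N d : ℕ, (N, d) ∈ D → 1 ≤ N ∧ N < 2 ^ (F.indexWords * d)) →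
      ∀ (A : DPSS.Algorithm) (tp tq td : ℕ → ℝ≥0), A.Solves F D tp tq td →
        ∃ P : WordRAM.Program, WordRAM.SortsIntegers P F.indexWords k D
          (fun N => tp N + C * (N * (tq N + td N))) := by
  refine ⟨WordRAM.timeFactor F k, fun D hD A tp tq td hA =>
    ⟨(WordRAM.sorter F.indexWords k F.paramWords A).code 0, fun N d hNd a ha => ?_⟩⟩
  obtain ⟨hN1, hN2⟩ := hD N d hNd
  have hd : 0 < d := by
    rcases Nat.eq_zero_or_pos d with rfl | h
    · simp at hN2; omega
    · exact h
  let X : WordRAM.Keys F.indexWords k d N := ⟨a, hd, by rwa [mul_comm], ha⟩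
  have hcost := WordRAM.cost_sorter_le (X := X) hparam hexp hmant hA hNd hN1
  refine ⟨(WordRAM.expectedTime_le_cost _ (WordRAM.penalty X) _).trans hcost, fun s' hs' => ?_⟩
  by_contra hbad
  have htop := WordRAM.cost_eq_top _ (WordRAM.penalty X) hs' (if_neg hbad)
  exact absurd (htop.ge.trans hcost) (not_le.2 ENNReal.coe_lt_top)
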